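/- Setting. Let $\mathcal X,\mathcal Y$ be finite nonempty alphabets and let $(\mathscr V,\mathscr E)$ be a connected directed acyclic graph; write $u\prec v$ if there is a directed path from $u$ to $v$, and $\mathrm{pa}(v)$ for the set of parents of $v$. The nodes are split into communication nodes $\mathscr C\neq\emptyset$ and initial nodes $\mathscr I=\mathscr V\setminus\mathscr C$, with no edge from $\mathscr C$ to $\mathscr I$, and $\mathscr V=\bigcup_n\mathcal V_n$ is an increasing union of finite sets that contain all predecessors of their elements; put $\mathcal C_n=\mathcal V_n\cap\mathscr C$. A poset-Markov channel assigns to every $v\in\mathscr C$ a transition law $P_{Y_v\mid X^{\preceq v},Y^{\prec v}}=P_{Y_v\mid X_v,Y_{\mathrm{pa}(v)}}$ (with inputs in $\mathcal X$, outputs in $\mathcal Y$); the outputs at the initial nodes have an arbitrary fixed joint law $P_0$. An $(n,M,\epsilon)$-code consists of encoders $f_v:[M]\times\mathcal Y^{\prec v}\to\mathcal X$, $v\in\mathcal C_n$, producing $X_v=f_v(W,Y^{\prec v})$ from a uniform message $W\in[M]$ independent of the initial outputs, and a decoder $g:\mathcal Y^{\mathcal C_n}\to[M]$, with $\mathbb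 P[W\ne g((Y_v)_{v\in\mathcal C_n})]\le\epsilon$. Let $M^*(n,\epsilon)$ be the largest such $M$. The feedback capacity is $C^{\mathrm{fb}}=\lim_{\epsilon\to0}\liminf_{n\to\infty}\frac1{|\mathcal C_n|}\log M^*(n,\epsilon)$. Further let $$C^{\mathrm{fb}}_{\mathrm{u.b.}}=\lim_{n\to\infty}\ \max\ \frac1{|\mathcal C_n|}\sum_{v\in\mathcal C_n}I(X_v;Y_v\mid Y_{\mathrm{pa}(v)}),$$ the maximum being over families of probability laws $(P_{X_v,Y_{\mathrm{pa}(v)}})_{v\in\mathcal C_n}$ such that, for all $u,v\in\mathcal C_n$, the laws indexed by $u$ and $v$ have the same marginal on $Y_{\mathrm{pa}(u)\cap\mathrm{pa}(v)}$, and, if $v\in\mathrm{pa}(u)$, the marginal of $Y_v$ in the law indexed by $u$ is the law of the channel output $\sum_{x_v,y_{\mathrm{pa}(v)}}P_{Y_v\mid X_v,Y_{\mathrm{pa}(v)}}P_{X_v,Y_{\mathrm{pa}(v)}}$. All logarithms are natural. The channel is approximately symmetric if: (1) $(\mathscr V,\mathscr E)$ is an induced subgraph of the Cayley graph, with edges $(g,gs_i)$,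 of a group generated by $d$ distinct elements $s_1,\dots,s_d$ no nonempty product of which is the identity, and every communication node has $d$ parents in $\mathscr V$; (2) if $\mathcal B_n$ is the set of nodes of $\mathcal V_n$ with in-degree or out-degree less than $d$ in the subgraph induced on $\mathcal V_n$, then $|\mathcal B_n|/|\mathcal C_n|\to0$; (3) there is a strictly positive transition law $Q_{Y\mid X,\overline Y'}$, $\overline Y'=(Y'_1,\dots,Y'_d)$, with $P_{Y_v\mid X_v,Y_{\mathrm{pa}(v)}}=Q_{Y\mid X,\overline Y'}$ for all $v\in\mathscr C$, where $Y_{\mathrm{pa}(v)}$ is read as the tuple $(Y_{vs_1^{-1}},\dots,Y_{vs_d^{-1}})$. For ordered subsets $\mathcal S=(i_1,\dots,i_k)$, $\mathcal T=(j_1,\dots,j_k)$ of $[d]$ (with distinct entries) write $\mathcal S\sim\mathcal T$ if there are $u,v\in\mathscr C$ with $us_{i_l}^{-1}=vs_{j_l}^{-1}$ for all $l$. Theorem (single-letter upper bound). For every approximately symmetric poset-Markov channel, the limits defining $C^{\mathrm{fb}}$ and $C^{\mathrm{fb}}_{\mathrm{u.b.}}$ exist and are finite, the maxima below and in the definition of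 $C^{\mathrm{fb}}_{\mathrm{u.b.}}$ are attained, and $$C^{\mathrm{fb}}\ \le\ C^{\mathrm{fb}}_{\mathrm{u.b.}}\ =\ \max_{P_{X,\overline Y'}} I(X;Y\mid\overline Y')\quad\text{s.t.}\quad P_Y=P_{Y'_i}\ \ \forall i\in[d],\qquad P_{Y'_{\mathcal S}}=P_{Y'_{\mathcal T}}\ \ \forall\,\mathcal S\sim\mathcal T,$$ where $Y$ is the output of $Q_{Y\mid X,\overline Y'}$ for $(X,\overline Y')\sim P_{X,\overline Y'}$. The right-hand side is a concave maximization problem: its feasible set is convex and its objective is concave in $P_{X,\overline Y'}$ on it. -/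

import Mathlib

open Filter Topology MeasureTheory

noncomputable section

/-! ### Finite-alphabet information quantities -/

/-- `IsFinLaw p`: the joint mass function `p` on the finite set `A × B` is a probability law. -/
def IsFinLaw {A B : Type*} [Fintype A] [Fintype B] (p : A → B → ℝ) : Prop :=
  (∀ a b, 0 ≤ p a b) ∧ ∑ a, ∑ b, p a b = 1

/-- Conditional mutual information `I(A;B|C)` (in nats) of a joint mass function on the finite set
`A × B × C`, that is
`∑ p(a,b,c) log (p(a,b,c) p(c) / (p(a,c) p(b,c)))`, with the convention `0 log 0 = 0`. -/
def condMutualInfo {A B C : Type*} [Fintype A] [Fintype B] [Fintype C] (p : A → B → C → ℝ) : ℝ :=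
  ∑ a, ∑ b, ∑ c, p a b c *
    Real.log ((p a b c * ∑ a', ∑ b', p a' b' c) / ((∑ b', p a b' c) * ∑ a', p a' b c))

/-- `I(X;Y|Z)` when `(X, Z)` has law `p` and `Y` is the output of the transition law `W`. -/
def channelInfo {A B C : Type*} [Fintype A] [Fintype B] [Fintype C]
    (W : A → C → B → ℝ) (p : A → C → ℝ) : ℝ :=
  condMutualInfo fun a b c => p a c * W a c b

/-- The law of the output `Y` when `(X, Z)` has law `p` and `Y` is the output of `W`. -/
def outputLaw {A B C : Type*} [Fintype A] [Fintype C]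
    (W : A → C → B → ℝ) (p : A → C → ℝ) (b : B) : ℝ :=
  ∑ a, ∑ c, p a c * W a c b

open Classical in
/-- Marginal law of the tuple `(Z (r j))_{j ∈ J}`, where `p` is the joint law of
`(X, (Z i)_{i ∈ I})`. -/
def tupleMarginal {A B I J : Type*} [Fintype A] [Fintype B] [Fintype I]
    (p : A → (I → B) → ℝ) (r : J → I) (z : J → B) : ℝ :=
  ∑ a, ∑ y : I → B, if (fun j => y (r j)) = z then p a y else 0

/-! ### The directed acyclic graph of a channel -/

/-- A connected directed acyclic graph, its communication nodes (the other nodes are the initial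
nodes), and an exhausting increasing sequence of finite sets of nodes, each closed under taking
predecessors in the order `v ≺ w` (there is a directed path from `v` to `w`). -/
structure ChannelDAG (V : Type*) where
  Edge : V → V → Prop
  acyclic : ∀ v, ¬ Relation.TransGen Edge v v
  nonempty : Nonempty V
  connected : ∀ u v, Relation.EqvGen Edge u v
  comm : Set V
  no_edge_comm_init : ∀ u v, u ∈ comm → v ∉ comm → ¬ Edge u v
  stage : ℕ → Finset V
  stage_mono : ∀ n, stage n ⊆ stage (n + 1)
  stage_exhaust : ∀ v, ∃ n, v ∈ stage n
  stage_lower : ∀ n v w, v ∈ stage n → Relation.TransGen Edge w v → w ∈ stage n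

namespace ChannelDAG

variable {V : Type*} (D : ChannelDAG V)

/-- The strict partial order: `D.Prec v w` if there is a directed path from `v` to `w`. -/
def Prec (v w : V) : Prop := Relation.TransGen D.Edge v w

/-- The communication nodes, as a type. -/
abbrev Comm : Type _ := {v : V // v ∈ D.comm}

/-- The initial nodes, as a type. -/
abbrev Init : Type _ := {v : V // v ∉ D.comm}

/-- The strict predecessors of `v`. -/
abbrev Past (v : V) : Type _ := {u : V // D.Prec u v}

/-- The communication nodes `u` with `u ≼ v`. -/
abbrev CommPast (v : V) : Type _ := {u : V // u ∈ D.comm ∧ (u = v ∨ D.Prec u v)}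

open Classical in
/-- The communication nodes of stage `n`. -/
def commStage (n : ℕ) : Finset V := (D.stage n).filter fun v => v ∈ D.comm

theorem mem_commStage {n : ℕ} {v : V} : v ∈ D.commStage n ↔ v ∈ D.stage n ∧ v ∈ D.comm := by
  classical
  simp [commStage]

/-- A communication node of stage `n`, seen as a communication node. -/
def toComm {n : ℕ} (v : D.commStage n) : D.Comm := ⟨v, (D.mem_commStage.1 v.2).2⟩

open Classical in
/-- The set of parents of `v`. -/
def parents (v : V) : Finset V :=
  (D.stage (D.stage_exhaust v).choose).filter fun u => D.Edge u v

theorem mem_parents {u v : V} : u ∈ D.parents v ↔ D.Edge u v := by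
  classical
  simp only [parents, Finset.mem_filter, and_iff_right_iff_imp]
  exact fun h => D.stage_lower _ v u (D.stage_exhaust v).choose_spec (.single h)

/-- A parent of `v`, seen as a strict predecessor of `v`. -/
def parentToPast {v : V} (u : D.parents v) : D.Past v :=
  ⟨u, Relation.TransGen.single (D.mem_parents.1 u.2)⟩

open Classical in
/-- Boundary nodes of stage `n`: the nodes whose in-degree or out-degree in the subgraph induced
on stage `n` is less than `d`. -/
def boundary (d n : ℕ) : Finset V :=
  (D.stage n).filter fun v =>
    ((D.stage n).filter fun u => D.Edge u v).card < d ∨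
      ((D.stage n).filter fun w => D.Edge v w).card < d

end ChannelDAG

/-! ### Poset-causal channels, codes and feedback capacity -/

/-- A poset-causal channel with input alphabet `X` and output alphabet `Y`: the transition laws
`P(Y_v | X^{≼ v}, Y^{≺ v})` at the communication nodes `v`, and the joint law of the outputs at the
initial nodes. -/
structure PosetCausalChannel {V : Type*} (D : ChannelDAG V) (X Y : Type*) [Fintype Y]
    [MeasurableSpace Y] where
  kernel : (v : D.Comm) → (D.CommPast v → X) → (D.Past v → Y) → Y → ℝ
  kernel_nonneg : ∀ v x y b, 0 ≤ kernel v x y b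
  kernel_sum : ∀ v x y, ∑ b, kernel v x y b = 1
  initLaw : Measure (D.Init → Y)
  initLaw_prob : IsProbabilityMeasure initLaw

namespace PosetCausalChannel

variable {V : Type*} {D : ChannelDAG V} {X Y : Type*} [Fintype Y] [MeasurableSpace Y]
  (ch : PosetCausalChannel D X Y)

/-- The encoders of an `n`-stage code with `M` messages: at each communication node `v` of stage
`n`, a map from the message and the outputs at the strict predecessors of `v` to the input. -/
abbrev Encoder (D : ChannelDAG V) (X Y : Type*) (n M : ℕ) : Type _ :=
  (v : D.commStage n) → Fin M → (D.Past v → Y) → X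

/-- The outputs at the strict predecessors of a node of stage `n`. -/
def pastOutputs {n : ℕ} (y : D.stage n → Y) (v : V) (hv : v ∈ D.stage n) : D.Past v → Y :=
  fun u => y ⟨u, D.stage_lower n v u hv u.2⟩

theorem commPast_mem {n : ℕ} {v : V} (hv : v ∈ D.stage n) (u : D.CommPast v) :
    (u : V) ∈ D.stage n := by
  rcases u.2.2 with h | h
  · rw [h]; exact hv
  · exact D.stage_lower n v u hv h

/-- The inputs at the communication nodes `u ≼ v` that the encoders produce from the message `w`
and the outputs `y`. -/
def pastInputs {n M : ℕ} (f : Encoder D X Y n M) (w : Fin M) (y : D.stage n → Y) (v : V)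
    (hv : v ∈ D.stage n) : D.CommPast v → X :=
  fun u => f ⟨u, D.mem_commStage.2 ⟨commPast_mem hv u, u.2.1⟩⟩ w
    (pastOutputs y u (commPast_mem hv u))

/-- The probability that the outputs on stage `n` are `y`, given that message `w` is sent. -/
def outputProb {n M : ℕ} (f : Encoder D X Y n M) (w : Fin M) (y : D.stage n → Y) : ℝ :=
  ch.initLaw.real {ω | ∀ (v : D.Init) (hv : (v : V) ∈ D.stage n), ω v = y ⟨v, hv⟩} *
    ∏ v : D.commStage n,
      ch.kernel (D.toComm v)
        (pastInputs f w y v (D.mem_commStage.1 v.2).1)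
        (pastOutputs y v (D.mem_commStage.1 v.2).1)
        (y ⟨v, (D.mem_commStage.1 v.2).1⟩)

/-- What the decoder observes: the outputs at the communication nodes of stage `n`. -/
def commOutputs {n : ℕ} (y : D.stage n → Y) : D.commStage n → Y :=
  fun v => y ⟨v, (D.mem_commStage.1 v.2).1⟩

open Classical in
/-- The error probability `P[W ≠ Ŵ]` of a code, the message `W` being uniform on `Fin M`. -/
def errorProb {n M : ℕ} (f : Encoder D X Y n M) (g : (D.commStage n → Y) → Fin M) : ℝ :=
  (∑ w : Fin M, ∑ y : D.stage n → Y,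
    if g (commOutputs y) ≠ w then ch.outputProb f w y else 0) / M

/-- There is an `(n, M, ε)`-code. -/
def HasCode (n M : ℕ) (ε : ℝ) : Prop :=
  ∃ (f : Encoder D X Y n M) (g : (D.commStage n → Y) → Fin M), ch.errorProb f g ≤ ε

/-- The maximal message size `M*(n, ε)`. For `0 ≤ ε < 1` and nonempty alphabets the set of
achievable `M` contains `1` and is bounded by `|Y| ^ |C_n| / (1 - ε)`, so this is a maximum. -/
def maxMessages (n : ℕ) (ε : ℝ) : ℕ := sSup {M | ch.HasCode n M ε}

/-- `C` is the feedback capacity `lim_{ε → 0} liminf_n (1 / |C_n|) log M*(n, ε)` (in nats). -/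
def IsFeedbackCapacity (C : ℝ) : Prop :=
  Tendsto (fun ε : ℝ => liminf (fun n : ℕ =>
      ((Real.log (ch.maxMessages n ε) / (D.commStage n).card : ℝ) : EReal)) atTop)
    (𝓝[>] 0) (𝓝 (C : EReal))

end PosetCausalChannel

/-! ### Poset-Markov channels and the local relaxation -/

/-- A poset-Markov channel: a poset-causal channel whose transition laws satisfy
`P(Y_v | X^{≼ v}, Y^{≺ v}) = P(Y_v | X_v, Y_{pa v})`. -/
structure PosetMarkovChannel {V : Type*} (D : ChannelDAG V) (X Y : Type*) [Fintype Y]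
    [MeasurableSpace Y] extends PosetCausalChannel D X Y where
  localKernel : (v : D.Comm) → X → (D.parents v → Y) → Y → ℝ
  markov : ∀ v x y b, kernel v x y b =
    localKernel v (x ⟨v, v.2, Or.inl rfl⟩) (fun u => y (D.parentToPast u)) b

namespace PosetMarkovChannel

variable {V : Type*} {D : ChannelDAG V} {X Y : Type*} [Fintype X] [Fintype Y] [MeasurableSpace Y]
  (ch : PosetMarkovChannel D X Y)

/-- A family of local joint laws `P_{X_v, Y_{pa v}}`, one for each communication node `v` of
stage `n`. -/
abbrev LocalLaws (D : ChannelDAG V) (X Y : Type*) (n : ℕ) : Type _ :=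
  (v : D.commStage n) → X → (D.parents v → Y) → ℝ

open Classical in
/-- Feasibility of a family of local laws: each member is a probability law; the law of `Y_v`
obtained at `v` through the channel agrees with the law of `Y_v` in the family member at any child
of `v`; and the members at `u` and `v` have the same marginal on `Y_{pa u ∩ pa v}`. -/
structure IsLocallyConsistent (n : ℕ) (p : LocalLaws D X Y n) : Prop where
  law : ∀ v, IsFinLaw (p v)
  channel : ∀ (v u : D.commStage n) (h : (v : V) ∈ D.parents u) (b : Y),
    outputLaw (ch.localKernel (D.toComm v)) (p v) b =
      tupleMarginal (p u) (fun _ : Unit => ⟨v, h⟩) (fun _ => b)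
  overlap : ∀ (u v : D.commStage n)
    (z : {w : V // w ∈ D.parents u ∧ w ∈ D.parents v} → Y),
    tupleMarginal (p u) (fun w => ⟨w.1, w.2.1⟩) z = tupleMarginal (p v) (fun w => ⟨w.1, w.2.2⟩) z

open Classical in
/-- The objective `(1 / |C_n|) ∑_{v ∈ C_n} I(X_v; Y_v | Y_{pa v})`. -/
def localObjective (n : ℕ) (p : LocalLaws D X Y n) : ℝ :=
  (∑ v : D.commStage n, channelInfo (ch.localKernel (D.toComm v)) (p v)) / (D.commStage n).card

/-- `C` is the limit over `n` of the maxima of the local objective over the locally consistent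
families of local laws (each maximum being attained). -/
def IsLocalUpperBound (C : ℝ) : Prop :=
  ∃ U : ℕ → ℝ,
    (∀ n, IsGreatest (ch.localObjective n '' {p | ch.IsLocallyConsistent n p}) (U n)) ∧
      Tendsto U atTop (𝓝 C)

end PosetMarkovChannel

/-! ### Approximately symmetric channels and the single-letter problem -/

/-- Approximate symmetry. Through `ι` the graph is an induced subgraph of the acyclic Cayley graph
of the group `G` with the `d` generators `s i` (edges `(g, g * s i)`), every communication node has
in-degree `d`, the number of boundary nodes is negligible, and all the transition laws are given by
one positive law `Q`, where `Y_{pa v}` is read as the `d`-tuple whose `i`-th entry is the output at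
the parent `ι v * (s i)⁻¹`. -/
structure PosetMarkovChannel.IsApproxSymmetric {V : Type*} {D : ChannelDAG V} {X Y : Type*}
    [Fintype Y] [MeasurableSpace Y] (ch : PosetMarkovChannel D X Y)
    {G : Type*} [Group G] {d : ℕ} (s : Fin d → G) (ι : V → G)
    (Q : X → (Fin d → Y) → Y → ℝ) : Prop where
  gen_injective : Function.Injective s
  gen_closure : Subgroup.closure (Set.range s) = ⊤
  cayley_acyclic : ∀ l : List (Fin d), l ≠ [] → (l.map s).prod ≠ 1
  embedding : Function.Injective ι
  induced : ∀ u v, D.Edge u v ↔ ∃ i, ι u * s i = ι v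
  in_degree : ∀ v ∈ D.comm, (D.parents v).card = d
  boundary_vanishing : Tendsto
    (fun n => ((D.boundary d n).card : ℝ) / ((D.commStage n).card : ℝ)) atTop (𝓝 0)
  law_pos : ∀ x z b, 0 < Q x z b
  law_sum : ∀ x z, ∑ b, Q x z b = 1
  stationary : ∀ (v : D.Comm) (x : X) (y : D.parents v → Y) (z : Fin d → Y),
    (∀ (i : Fin d) (u : D.parents v), ι u * s i = ι v → y u = z i) →
      ∀ b, ch.localKernel v x y b = Q x z b

/-- Equivalence of the ordered subsets `S`, `T` of `Fin d` (given as injective enumerations): for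
some communication nodes `u`, `v`, the tuple of parents of `u` selected by `S` equals the tuple of
parents of `v` selected by `T`. -/
def OrderedSubsetEquiv {V : Type*} (D : ChannelDAG V) {G : Type*} [Group G] {d k : ℕ}
    (s : Fin d → G) (ι : V → G) (S T : Fin k ↪ Fin d) : Prop :=
  ∃ u ∈ D.comm, ∃ v ∈ D.comm, ∀ l, ι u * (s (S l))⁻¹ = ι v * (s (T l))⁻¹

/-- The feasible set of the single-letter problem: the joint laws of `(X, (Y'_i)_i)` with
`P_Y = P_{Y'_i}` for all `i` and `P_{Y'_S} = P_{Y'_T}` for all equivalent ordered subsets. -/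
def singleLetterFeasible {V : Type*} (D : ChannelDAG V) {X Y : Type*} [Fintype X] [Fintype Y]
    {G : Type*} [Group G] {d : ℕ} (s : Fin d → G) (ι : V → G) (Q : X → (Fin d → Y) → Y → ℝ) :
    Set (X → (Fin d → Y) → ℝ) :=
  {p | IsFinLaw p ∧
    (∀ (i : Fin d) (b : Y), outputLaw Q p b = tupleMarginal p (fun _ : Unit => i) fun _ => b) ∧
    ∀ (k : ℕ) (S T : Fin k ↪ Fin d), OrderedSubsetEquiv D s ι S T →
      ∀ z : Fin k → Y, tupleMarginal p S z = tupleMarginal p T z}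

end

/-!
The bound is Fano's inequality followed by a symmetrization over the Cayley graph.

*Converse for codes.* A code induces a joint law of the message and the outputs of stage `n`. Its
local laws `P_{X_v, Y_{pa v}}` form a locally consistent family, because they are marginals of one
law and because the output at `v` is generated by the transition law at `v`
(`isLocallyConsistent_codeLaw`). The latter is `sum_causal_mul_indicator`: a product of causal
transition laws has a total mass that does not depend on these laws, and perturbing the law at `v`
gives the conditional law at `v`. The joint law is then compared with the law under which the
message is independent of the outputs and the outputs follow their local conditional laws given the
outputs of the parents. The log-likelihood ratio has mean `∑ v, I(X_v; Y_v | Y_{pa v})`, and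
`log t ≤ t - 1` turns the comparison into Fano's inequality (`log_messages_le`).

*Concavity.* Since the transition law is positive, `I(X; Y | Z)` is the minimum over the positive
transition laws `q` of `𝔼 log (W(Y|X,Z) / q(Y|Z))`, which is linear in the law of `(X, Z)`
(`channelInfo_le_cross`). Hence it is concave, and it is continuous as a finite sum of terms
`t log t`.

*From local laws to one law and back.* A feasible law of the single-letter problem, placed at every
node, is a locally consistent family with the same objective (`isLocallyConsistent_localLaw`).
Conversely the average over the nodes of a locally consistent family has at least the same objective
by concavity, and violates the single-letter constraints by at most a multiple of
`|B_n| / |C_n|`: each constraint compares the local laws at `v` and at a translate `v * g`, where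
`g` is a generator `s i` or a quotient `(s i)⁻¹ * s j`, and translation by `g` is a bijection of the
stage onto itself up to `2 |B_n|` nodes (`card_shiftDefect_le_boundary`,
`card_shiftDefect_mul_le`). Compactness then shows that the maxima of the local objectives tend to
the single-letter maximum. It also shows that the single-letter problem is feasible, by starting
from the local laws of an arbitrary code.
-/

/-! ### Conditional mutual information through a positive channel -/

section Information

variable {A B C : Type*} [Fintype A]

/-- The conditional law of the output `Y` given `Z = c`, when `(X, Z)` has law `p` and `Y` is the
output of `W`. Where `Z = c` has probability zero, it is the law of the output for the input `x₀`,
so that it is a positive law everywhere when `W` is one. -/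
noncomputable def outputCond (W : A → C → B → ℝ) (x₀ : A) (p : A → C → ℝ) (c : C) (b : B) : ℝ :=
  if ∑ a, p a c = 0 then W x₀ c b else (∑ a, p a c * W a c b) / ∑ a, p a c

variable {W : A → C → B → ℝ} {p : A → C → ℝ}

theorem sum_mul_channel_pos (hW : ∀ a c b, 0 < W a c b) (hp : ∀ a c, 0 ≤ p a c) {a : A} {c : C}
    (h : p a c ≠ 0) (b : B) : 0 < ∑ a, p a c * W a c b :=
  Finset.sum_pos' (fun a _ => mul_nonneg (hp a c) (hW a c b).le)
    ⟨a, Finset.mem_univ a, mul_pos ((hp a c).lt_of_ne' h) (hW a c b)⟩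

theorem sum_input_pos (hp : ∀ a c, 0 ≤ p a c) {a : A} {c : C} (h : p a c ≠ 0) :
    0 < ∑ a, p a c :=
  Finset.sum_pos' (fun a _ => hp a c) ⟨a, Finset.mem_univ a, (hp a c).lt_of_ne' h⟩

theorem outputCond_pos (hW : ∀ a c b, 0 < W a c b) (hp : ∀ a c, 0 ≤ p a c) (x₀ : A) (c : C)
    (b : B) : 0 < outputCond W x₀ p c b := by
  unfold outputCond
  split_ifs with h
  · exact hW _ _ _
  · obtain ⟨a, -, ha⟩ := Finset.exists_ne_zero_of_sum_ne_zero h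
    exact div_pos (sum_mul_channel_pos hW hp ha b) (sum_input_pos hp ha)

theorem sum_outputCond [Fintype B] (hW1 : ∀ a c, ∑ b, W a c b = 1) (x₀ : A) (c : C) :
    ∑ b, outputCond W x₀ p c b = 1 := by
  unfold outputCond
  split_ifs with h
  · exact hW1 _ _
  · rw [← Finset.sum_div, Finset.sum_comm]
    simp_rw [← Finset.mul_sum, hW1, mul_one]
    exact div_self h

theorem sum_input_mul_outputCond (hp : ∀ a c, 0 ≤ p a c) (x₀ : A) (c : C) (b : B) :
    (∑ a, p a c) * outputCond W x₀ p c b = ∑ a, p a c * W a c b := by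
  unfold outputCond
  split_ifs with h
  · have h0 := (Finset.sum_eq_zero_iff_of_nonneg fun a _ => hp a c).1 h
    rw [h, zero_mul, Finset.sum_eq_zero]
    intro a ha
    rw [h0 a ha, zero_mul]
  · field_simp

/-- The conditional mutual information with its logarithm expanded. The terms with `p a c = 0`
vanish on both sides; in the others all the factors are positive, as `W` is. -/
theorem channelInfo_eq_sum [Fintype B] [Fintype C] (hW : ∀ a c b, 0 < W a c b)
    (hW1 : ∀ a c, ∑ b, W a c b = 1) (hp : ∀ a c, 0 ≤ p a c) :
    channelInfo W p = ∑ a, ∑ b, ∑ c, p a c * W a c b *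
      (Real.log (W a c b) + Real.log (∑ a, p a c) - Real.log (∑ a, p a c * W a c b)) := by
  unfold channelInfo condMutualInfo
  refine Finset.sum_congr rfl fun a _ => Finset.sum_congr rfl fun b _ =>
    Finset.sum_congr rfl fun c _ => ?_
  simp_rw [← Finset.mul_sum, hW1, mul_one]
  by_cases h : p a c = 0
  · simp [h]
  · have h1 := sum_mul_channel_pos hW hp h b
    have h2 := sum_input_pos hp h
    rw [mul_assoc (p a c) _ (∑ a, p a c), mul_div_mul_left _ _ h,
      Real.log_div (mul_pos (hW a c b) h2).ne' h1.ne',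
      Real.log_mul (hW a c b).ne' h2.ne']

/-- The minimum in `channelInfo_le_cross` is attained at the conditional law of the output. -/
theorem channelInfo_eq_outputCond [Fintype B] [Fintype C] (hW : ∀ a c b, 0 < W a c b)
    (hW1 : ∀ a c, ∑ b, W a c b = 1) (hp : ∀ a c, 0 ≤ p a c) (x₀ : A) :
    channelInfo W p = ∑ a, ∑ b, ∑ c, p a c * W a c b *
      Real.log (W a c b / outputCond W x₀ p c b) := by
  rw [channelInfo_eq_sum hW hW1 hp]
  refine Finset.sum_congr rfl fun a _ => Finset.sum_congr rfl fun b _ =>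
    Finset.sum_congr rfl fun c _ => ?_
  by_cases h : p a c = 0
  · simp [h]
  · have h1 := sum_mul_channel_pos hW hp h b
    have h2 := sum_input_pos hp h
    rw [outputCond, if_neg h2.ne', Real.log_div (hW a c b).ne' (div_pos h1 h2).ne',
      Real.log_div h1.ne' h2.ne']
    ring

/-- The conditional mutual information is the smallest of the functions
`p ↦ 𝔼 log (W(Y|X,Z) / q(Y|Z))`, linear in `p`, over the positive transition laws `q`. -/
theorem channelInfo_le_cross [Fintype B] [Fintype C] (hW : ∀ a c b, 0 < W a c b)
    (hW1 : ∀ a c, ∑ b, W a c b = 1)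
    (hp : ∀ a c, 0 ≤ p a c) (q : C → B → ℝ) (hq : ∀ c b, 0 < q c b)
    (hq1 : ∀ c, ∑ b, q c b = 1) :
    channelInfo W p ≤ ∑ a, ∑ b, ∑ c, p a c * W a c b * Real.log (W a c b / q c b) := by
  by_cases hA : Nonempty A
  swap
  · have : IsEmpty A := not_nonempty_iff.1 hA
    simp [channelInfo, condMutualInfo]
  obtain ⟨x₀⟩ := hA
  rw [channelInfo_eq_outputCond hW hW1 hp x₀, ← sub_nonpos]
  simp_rw [← Finset.sum_sub_distrib]
  have key : ∀ a b c, p a c * W a c b * Real.log (W a c b / outputCond W x₀ p c b) -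
      p a c * W a c b * Real.log (W a c b / q c b) ≤
      p a c * W a c b * (q c b / outputCond W x₀ p c b) - p a c * W a c b := by
    intro a b c
    have ho := outputCond_pos hW hp x₀ c b
    have := Real.log_le_sub_one_of_pos (div_pos (hq c b) ho)
    rw [Real.log_div (hq c b).ne' ho.ne'] at this
    rw [Real.log_div (hW a c b).ne' ho.ne', Real.log_div (hW a c b).ne' (hq c b).ne']
    have := mul_le_mul_of_nonneg_left this (mul_nonneg (hp a c) (hW a c b).le)
    linarith
  refine (Finset.sum_le_sum fun a _ => Finset.sum_le_sum fun b _ => Finset.sum_le_sum fun c _ =>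
    key a b c).trans ?_
  simp_rw [Finset.sum_sub_distrib]
  have e1 : ∑ a, ∑ b, ∑ c, p a c * W a c b * (q c b / outputCond W x₀ p c b) =
      ∑ c, ∑ a, p a c := by
    calc _ = ∑ c, ∑ b, (∑ a, p a c * W a c b) * (q c b / outputCond W x₀ p c b) := by
          rw [Finset.sum_comm, Finset.sum_congr rfl fun b _ => Finset.sum_comm, Finset.sum_comm]
          simp_rw [Finset.sum_mul]
      _ = ∑ c, ∑ b, (∑ a, p a c) * q c b := by
          refine Finset.sum_congr rfl fun c _ => Finset.sum_congr rfl fun b _ => ?_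
          rw [← sum_input_mul_outputCond hp x₀ c b]
          have := (outputCond_pos hW hp x₀ c b).ne'
          field_simp
      _ = _ := by simp_rw [← Finset.mul_sum, hq1, mul_one]
  have e2 : ∑ a, ∑ b, ∑ c, p a c * W a c b = ∑ c, ∑ a, p a c := by
    rw [Finset.sum_congr rfl fun a _ => Finset.sum_comm, Finset.sum_comm]
    simp_rw [← Finset.mul_sum, hW1, mul_one]
  rw [e1, e2, sub_self]

/-- Concavity in the form of Jensen's inequality. The upper bounds of `channelInfo_le_cross` are
linear in the law; they are taken at the conditional output law of the mixture, where they are sharp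
for the mixture. -/
theorem sum_channelInfo_le [Fintype B] [Fintype C] {J : Type*} (t : Finset J) (w : J → ℝ)
    (P : J → A → C → ℝ)
    (hw : ∀ j ∈ t, 0 ≤ w j) (hW : ∀ a c b, 0 < W a c b) (hW1 : ∀ a c, ∑ b, W a c b = 1)
    (hP : ∀ j ∈ t, ∀ a c, 0 ≤ P j a c) :
    ∑ j ∈ t, w j * channelInfo W (P j) ≤ channelInfo W (fun a c => ∑ j ∈ t, w j * P j a c) := by
  by_cases hA : Nonempty A
  swap
  · have : IsEmpty A := not_nonempty_iff.1 hA
    simp [channelInfo, condMutualInfo]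
  obtain ⟨x₀⟩ := hA
  have hp : ∀ a c, 0 ≤ ∑ j ∈ t, w j * P j a c := fun a c =>
    Finset.sum_nonneg fun j hj => mul_nonneg (hw j hj) (hP j hj a c)
  rw [channelInfo_eq_outputCond hW hW1 hp x₀]
  set q := outputCond W x₀ (fun a c => ∑ j ∈ t, w j * P j a c)
  refine (Finset.sum_le_sum fun j hj => mul_le_mul_of_nonneg_left
    (channelInfo_le_cross hW hW1 (hP j hj) q (outputCond_pos hW hp x₀)
      (sum_outputCond hW1 x₀)) (hw j hj)).trans_eq ?_
  simp_rw [Finset.mul_sum]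
  rw [Finset.sum_comm]
  refine Finset.sum_congr rfl fun a _ => ?_
  rw [Finset.sum_comm]
  refine Finset.sum_congr rfl fun b _ => ?_
  rw [Finset.sum_comm]
  refine Finset.sum_congr rfl fun c _ => ?_
  rw [Finset.sum_mul, Finset.sum_mul]
  exact Finset.sum_congr rfl fun j _ => by ring

theorem continuousOn_channelInfo [Fintype B] [Fintype C] (hW : ∀ a c b, 0 < W a c b)
    (hW1 : ∀ a c, ∑ b, W a c b = 1) :
    ContinuousOn (channelInfo W) {p | ∀ a c, 0 ≤ p a c} := by
  have h : Continuous fun p : A → C → ℝ => (∑ a, ∑ b, ∑ c, p a c * W a c b * Real.log (W a c b)) +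
      (∑ c, (∑ a, p a c) * Real.log (∑ a, p a c)) -
      ∑ c, ∑ b, (∑ a, p a c * W a c b) * Real.log (∑ a, p a c * W a c b) := by
    have hl := Real.continuous_mul_log
    refine (Continuous.add (by fun_prop) ?_).sub ?_
    · exact continuous_finsetSum _ fun c _ =>
        hl.comp (by fun_prop : Continuous fun p : A → C → ℝ => ∑ a, p a c)
    · exact continuous_finsetSum _ fun c _ => continuous_finsetSum _ fun b _ =>
        hl.comp (by fun_prop : Continuous fun p : A → C → ℝ => ∑ a, p a c * W a c b)
  refine h.continuousOn.congr fun p hp => ?_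
  dsimp only
  rw [channelInfo_eq_sum hW hW1 hp]
  simp_rw [mul_sub, mul_add, Finset.sum_sub_distrib, Finset.sum_add_distrib]
  congr 1
  · congr 1
    rw [Finset.sum_congr rfl fun a _ => Finset.sum_comm, Finset.sum_comm]
    simp_rw [← Finset.sum_mul, ← Finset.mul_sum, hW1, mul_one]
  · rw [Finset.sum_comm, Finset.sum_congr rfl fun b _ => Finset.sum_comm, Finset.sum_comm]
    simp_rw [← Finset.sum_mul]

theorem channelInfo_reindex [Fintype B] [Fintype C] {C' : Type*} [Fintype C'] (e : C' ≃ C)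
    (W : A → C → B → ℝ) (p : A → C → ℝ) :
    channelInfo (fun a c => W a (e c)) (fun a c => p a (e c)) = channelInfo W p := by
  unfold channelInfo condMutualInfo
  refine Finset.sum_congr rfl fun a _ => Finset.sum_congr rfl fun b _ => ?_
  exact e.sum_comp fun c => p a c * W a c b *
    Real.log (p a c * W a c b * (∑ a', ∑ b', p a' c * W a' c b') /
      ((∑ b', p a c * W a c b') * ∑ a', p a' c * W a' c b))

theorem outputLaw_reindex [Fintype C] {C' : Type*} [Fintype C'] (e : C' ≃ C) (W : A → C → B → ℝ)
    (p : A → C → ℝ) (b : B) :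
    outputLaw (fun a c => W a (e c)) (fun a c => p a (e c)) b = outputLaw W p b :=
  Finset.sum_congr rfl fun a _ => e.sum_comp fun c => p a c * W a c b

theorem IsFinLaw.reindex [Fintype C] {C' : Type*} [Fintype C'] (e : C' ≃ C) (hp : IsFinLaw p) :
    IsFinLaw fun a c => p a (e c) :=
  ⟨fun _ _ => hp.1 _ _, (Finset.sum_congr rfl fun a _ => e.sum_comp fun c => p a c).trans hp.2⟩

theorem IsFinLaw.le_one [Fintype C] (hp : IsFinLaw p) (a : A) (c : C) : p a c ≤ 1 := by
  rw [← hp.2]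
  exact (Finset.single_le_sum (f := fun c => p a c) (fun c _ => hp.1 a c)
    (Finset.mem_univ c)).trans (Finset.single_le_sum (f := fun a => ∑ c, p a c)
      (fun a _ => Finset.sum_nonneg fun c _ => hp.1 a c) (Finset.mem_univ a))

theorem isClosed_isFinLaw [Fintype C] : IsClosed {p : A → C → ℝ | IsFinLaw p} := by
  have : {p : A → C → ℝ | IsFinLaw p} =
      (⋂ a, ⋂ c, {p | 0 ≤ p a c}) ∩ {p | ∑ a, ∑ c, p a c = 1} := by
    ext p; simp [IsFinLaw]
  rw [this]
  exact (isClosed_iInter fun a => isClosed_iInter fun c =>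
    isClosed_le continuous_const (by fun_prop)).inter (isClosed_eq (by fun_prop) continuous_const)

theorem isCompact_isFinLaw [Fintype C] : IsCompact {p : A → C → ℝ | IsFinLaw p} := by
  refine (isCompact_univ_pi fun _ : A => isCompact_univ_pi fun _ : C =>
    isCompact_Icc (a := (0 : ℝ)) (b := 1)).of_isClosed_subset isClosed_isFinLaw ?_
  exact fun p hp a _ c _ => ⟨hp.1 a c, hp.le_one a c⟩

theorem IsFinLaw.sum_smul [Fintype C] {J : Type*} {t : Finset J} {w : J → ℝ} {P : J → A → C → ℝ}
    (hw : ∀ j ∈ t, 0 ≤ w j) (hw1 : ∑ j ∈ t, w j = 1) (hP : ∀ j ∈ t, IsFinLaw (P j)) :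
    IsFinLaw fun a c => ∑ j ∈ t, w j * P j a c := by
  refine ⟨fun a c => Finset.sum_nonneg fun j hj => mul_nonneg (hw j hj) ((hP j hj).1 a c), ?_⟩
  rw [Finset.sum_congr rfl fun a _ => Finset.sum_comm, Finset.sum_comm, ← hw1]
  refine Finset.sum_congr rfl fun j hj => ?_
  simp_rw [← Finset.mul_sum]
  rw [(hP j hj).2, mul_one]

theorem continuous_outputLaw [Fintype C] (W : A → C → B → ℝ) (b : B) :
    Continuous fun p : A → C → ℝ => outputLaw W p b := by
  unfold outputLaw
  fun_prop

theorem outputLaw_sum [Fintype C] {J : Type*} (t : Finset J) (w : J → ℝ) (P : J → A → C → ℝ)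
    (b : B) :
    outputLaw W (fun a c => ∑ j ∈ t, w j * P j a c) b = ∑ j ∈ t, w j * outputLaw W (P j) b := by
  unfold outputLaw
  simp_rw [Finset.sum_mul, Finset.mul_sum]
  rw [Finset.sum_congr rfl fun a _ => Finset.sum_comm, Finset.sum_comm]
  simp_rw [mul_assoc]

theorem outputLaw_nonneg [Fintype C] (hW : ∀ a c b, 0 ≤ W a c b) (hp : ∀ a c, 0 ≤ p a c) (b : B) :
    0 ≤ outputLaw W p b :=
  Finset.sum_nonneg fun a _ => Finset.sum_nonneg fun c _ => mul_nonneg (hp a c) (hW a c b)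

theorem outputLaw_le_one [Fintype C] (hW : ∀ a c b, W a c b ≤ 1) (hp : IsFinLaw p) (b : B) :
    outputLaw W p b ≤ 1 := by
  rw [← hp.2]
  exact Finset.sum_le_sum fun a _ => Finset.sum_le_sum fun c _ =>
    mul_le_of_le_one_right (hp.1 a c) (hW a c b)

end Information

section Marginals

variable {A B I J K : Type*}

open Classical in
/-- The deterministic channel that outputs the subtuple `(z (r j))_j` of the tuple `z`. A marginal
law of a tuple is the output law of this channel. -/
noncomputable def selectionChannel (r : J → I) : A → (I → B) → (J → B) → ℝ :=
  fun _ y z => if (fun j => y (r j)) = z then 1 else 0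

theorem selectionChannel_nonneg (r : J → I) (a : A) (y : I → B) (z : J → B) :
    0 ≤ selectionChannel r a y z := by
  unfold selectionChannel; split_ifs <;> norm_num

theorem selectionChannel_le_one (r : J → I) (a : A) (y : I → B) (z : J → B) :
    selectionChannel r a y z ≤ 1 := by
  unfold selectionChannel; split_ifs <;> norm_num

variable [Fintype A] [Fintype B] [Fintype I]

/-- The `Fintype` instance is arbitrary, so as to absorb the classical instance that
`tupleMarginal` is defined with. -/
theorem tupleMarginal_eq_outputLaw [Fintype (I → B)] (p : A → (I → B) → ℝ) (r : J → I)
    (z : J → B) :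
    tupleMarginal p r z = outputLaw (selectionChannel r) p z := by
  unfold tupleMarginal outputLaw selectionChannel
  refine Finset.sum_congr rfl fun a _ => ?_
  simp_rw [mul_ite, mul_one, mul_zero]
  congr!

theorem continuous_tupleMarginal (r : J → I) (z : J → B) :
    Continuous fun p : A → (I → B) → ℝ => tupleMarginal p r z := by
  classical
  simp_rw [tupleMarginal_eq_outputLaw]
  exact continuous_outputLaw _ _

/-- The law of a subtuple of `(Z (r j))_j` is a marginal of the law of `(Z (r j))_j`. -/
theorem tupleMarginal_comp [Fintype (J → B)] (p : A → (I → B) → ℝ) (r : J → I) (g : K → J)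
    (z : K → B) :
    tupleMarginal p (fun k => r (g k)) z =
      ∑ z' : J → B, tupleMarginal p r z' * selectionChannel g () z' z := by
  classical
  simp_rw [tupleMarginal_eq_outputLaw, outputLaw, Finset.sum_mul]
  conv_rhs => rw [Finset.sum_comm]
  refine Finset.sum_congr rfl fun a _ => ?_
  conv_rhs => rw [Finset.sum_comm]
  refine Finset.sum_congr rfl fun y _ => ?_
  rw [Finset.sum_eq_single fun j => y (r j)]
  · simp [selectionChannel]
  · intro z' _ h
    simp [selectionChannel, h.symm]
  · simp

theorem tupleMarginal_comp_congr [Finite J] {I' : Type*} [Fintype I'] {p : A → (I → B) → ℝ}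
    {p' : A → (I' → B) → ℝ} {r : J → I} {r' : J → I'}
    (h : ∀ z, tupleMarginal p r z = tupleMarginal p' r' z) (g : K → J) (z : K → B) :
    tupleMarginal p (fun k => r (g k)) z = tupleMarginal p' (fun k => r' (g k)) z := by
  classical
  have := Fintype.ofFinite J
  simp_rw [tupleMarginal_comp, h]

theorem tupleMarginal_reindex {I' : Type*} [Fintype I'] (e : I ≃ I') (p : A → (I → B) → ℝ)
    (r : J → I) (z : J → B) :
    tupleMarginal (fun a (y : I' → B) => p a fun i => y (e i)) (fun j => e (r j)) z =
      tupleMarginal p r z := by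
  classical
  simp_rw [tupleMarginal_eq_outputLaw]
  exact outputLaw_reindex (e.symm.arrowCongr (Equiv.refl B)) (selectionChannel r) p z

end Marginals

/-! ### Laws built from causal transition laws -/

section Causal

variable {N K Y : Type*} [Fintype N] [DecidableEq N] [Fintype Y]

theorem sum_sum_update (a : N) (F : (N → Y) → ℝ) :
    ∑ y, ∑ b, F (Function.update y a b) = Fintype.card Y * ∑ y, F y := by
  -- `(y, b) ↦ (update y a b, y a)` is an involution.
  let e : ((N → Y) × Y) ≃ ((N → Y) × Y) :=
    { toFun := fun x => (Function.update x.1 a x.2, x.1 a)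
      invFun := fun x => (Function.update x.1 a x.2, x.1 a)
      left_inv := fun x => by simp
      right_inv := fun x => by simp }
  calc ∑ y, ∑ b, F (Function.update y a b) = ∑ x : (N → Y) × Y, F (e x).1 := by
        rw [Fintype.sum_prod_type]; rfl
    _ = ∑ x : (N → Y) × Y, F x.1 := e.sum_comp fun x => F x.1
    _ = _ := by rw [Fintype.sum_prod_type]; simp [Finset.mul_sum]

/-- Summing out a coordinate that enters only through a transition law to it. -/
theorem sum_mul_transition (a : N) (g : (N → Y) → ℝ) (κ : (N → Y) → Y → ℝ)
    (hg : ∀ y b, g (Function.update y a b) = g y) (hκ : ∀ y b, κ (Function.update y a b) = κ y)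
    (hκ1 : ∀ y, ∑ b, κ y b = 1) :
    Fintype.card Y * ∑ y, g y * κ y (y a) = ∑ y, g y := by
  rw [← sum_sum_update a]
  refine Finset.sum_congr rfl fun y _ => ?_
  simp_rw [hg, hκ, Function.update_self, ← Finset.mul_sum, hκ1, mul_one]

variable {R : N → N → Prop} {j : K → N} {μ : (N → Y) → ℝ} {κ : K → (N → Y) → Y → ℝ}

/-- Integrating out the nodes of `A`, from the last to the first. Each transition law `κ k` looks
only at the coordinates that precede `j k` in the order `R`, and `μ` at none of the coordinates in
the range of `j`. The right-hand side does not depend on `κ`. -/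
theorem sum_causal_finset (hR : ∀ u v w, R u v → R v w → R u w) (hR' : ∀ u, ¬ R u u)
    (hj : Function.Injective j)
    (hμ : ∀ k y b, μ (Function.update y (j k) b) = μ y)
    (hκ : ∀ k u y b, ¬ R u (j k) → κ k (Function.update y u b) = κ k y)
    (hκ1 : ∀ k y, ∑ b, κ k y b = 1) (A : Finset K) :
    (Fintype.card Y : ℝ) ^ A.card * ∑ y, μ y * ∏ k ∈ A, κ k y (y (j k)) = ∑ y, μ y := by
  classical
  induction hn : A.card generalizing A with
  | zero => simp [Finset.card_eq_zero.1 hn]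
  | succ n ih =>
    have hne : A.Nonempty := Finset.card_pos.1 (by omega)
    -- a node of `A` that does not precede any other node of `A`
    obtain ⟨a, ha, hmax⟩ : ∃ a ∈ A, ∀ b ∈ A, ¬ R (j a) (j b) := by
      let r : A → A → Prop := fun x y => R (j y) (j x)
      have : IsTrans A r := ⟨fun x y z h h' => hR _ _ _ h' h⟩
      have : Std.Irrefl r := ⟨fun x => hR' _⟩
      have hw : WellFounded r := Finite.wellFounded_of_trans_of_irrefl r
      obtain ⟨m, -, hm⟩ := hw.has_min Set.univ ⟨⟨_, hne.choose_spec⟩, trivial⟩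
      exact ⟨m, m.2, fun b hb => hm ⟨b, hb⟩ trivial⟩
    have hc : (A.erase a).card = n := by rw [Finset.card_erase_of_mem ha, hn]; rfl
    rw [← ih (A.erase a) hc, pow_succ, mul_assoc]
    congr 1
    rw [← sum_mul_transition (j a) (fun y => μ y * ∏ k ∈ A.erase a, κ k y (y (j k))) (κ a) ?_
      (fun y b => hκ a _ y b (hR' _)) (hκ1 a)]
    · congr 1
      refine Finset.sum_congr rfl fun y _ => ?_
      rw [← Finset.mul_prod_erase A _ ha]
      ring
    · intro y b
      rw [hμ]
      congr 1
      refine Finset.prod_congr rfl fun k hk => ?_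
      rw [hκ k _ _ _ (hmax k (Finset.mem_of_mem_erase hk)),
        Function.update_of_ne (hj.ne (Finset.ne_of_mem_erase hk))]

variable [Fintype K]

/-- The causal disintegration: if `P = μ ∏ κ k` is built from causal transition laws, then under
`P` the transition law at `k` is the conditional law of the coordinate `j k` given the coordinates
preceding it. Multiplying `κ k` by `1 + φ (1_b - κ k b)` yields another transition law, and the
total mass does not depend on the transition laws. -/
theorem sum_causal_mul_indicator (hR : ∀ u v w, R u v → R v w → R u w) (hR' : ∀ u, ¬ R u u)
    (hj : Function.Injective j)
    (hμ : ∀ k y b, μ (Function.update y (j k) b) = μ y)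
    (hκ : ∀ k u y b, ¬ R u (j k) → κ k (Function.update y u b) = κ k y)
    (hκ1 : ∀ k y, ∑ b, κ k y b = 1) [Nonempty Y] [DecidableEq Y] (k : K) (φ : (N → Y) → ℝ)
    (hφ : ∀ u y b, ¬ R u (j k) → φ (Function.update y u b) = φ y) (b : Y) :
    ∑ y, (μ y * ∏ k, κ k y (y (j k))) * (φ y * if y (j k) = b then 1 else 0) =
      ∑ y, (μ y * ∏ k, κ k y (y (j k))) * (φ y * κ k y b) := by
  classical
  let δ : (N → Y) → Y → ℝ := fun y c => 1 + φ y * ((if c = b then 1 else 0) - κ k y b)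
  let κ' : K → (N → Y) → Y → ℝ := fun l y c => if l = k then κ l y c * δ y c else κ l y c
  have hκ' : ∀ l u y c, ¬ R u (j l) → κ' l (Function.update y u c) = κ' l y := by
    intro l u y c h
    ext c'
    by_cases hl : l = k
    · subst hl
      simp only [κ', δ, if_true, hκ l u y c h, hφ u y c h]
    · simp only [κ', if_neg hl, hκ l u y c h]
  have hκ1' : ∀ l y, ∑ c, κ' l y c = 1 := by
    intro l y
    by_cases hl : l = k
    · subst hl
      simp only [κ', δ, if_true, mul_add, mul_one, mul_sub, Finset.sum_add_distrib,
        Finset.sum_sub_distrib, hκ1]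
      have e1 : ∑ c, κ l y c * (φ y * if c = b then 1 else 0) = κ l y b * φ y := by
        simp
      rw [e1, ← Finset.sum_mul, hκ1]
      ring
    · simp only [κ', if_neg hl, hκ1]
  have h := (sum_causal_finset hR hR' hj hμ hκ hκ1 Finset.univ).trans
    (sum_causal_finset hR hR' hj hμ hκ' hκ1' Finset.univ).symm
  have hY : (Fintype.card Y : ℝ) ^ (Finset.univ : Finset K).card ≠ 0 := by positivity
  have h2 := mul_left_cancel₀ hY h
  have h3 : ∀ y : N → Y, ∏ l, κ' l y (y (j l)) = (∏ l, κ l y (y (j l))) * δ y (y (j k)) := by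
    intro y
    simp only [κ']
    rw [← Finset.mul_prod_erase _ _ (Finset.mem_univ k),
      ← Finset.mul_prod_erase (Finset.univ) (fun l => κ l y (y (j l))) (Finset.mem_univ k)]
    rw [Finset.prod_congr rfl fun l hl => if_neg (Finset.ne_of_mem_erase hl), if_pos rfl]
    ring
  simp_rw [h3, δ] at h2
  rw [← sub_eq_zero, ← Finset.sum_sub_distrib]
  rw [eq_comm, ← sub_eq_zero, ← Finset.sum_sub_distrib] at h2
  exact (Finset.sum_congr rfl fun y _ => by ring).trans h2

end Causal

namespace PosetCausalChannel

variable {V : Type*} {D : ChannelDAG V} {X Y : Type*} [Fintype Y] [MeasurableSpace Y]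

/-- The probability that the outputs at the initial nodes of stage `n` are those of `y`. -/
noncomputable def initProb (ch : PosetCausalChannel D X Y) {n : ℕ} (y : D.stage n → Y) : ℝ :=
  ch.initLaw.real {ω | ∀ (v : D.Init) (hv : (v : V) ∈ D.stage n), ω v = y ⟨v, hv⟩}

theorem commStage_mem {n : ℕ} (v : D.commStage n) : (v : V) ∈ D.stage n :=
  (D.mem_commStage.1 v.2).1

/-- A node of `commStage` as a node of the stage. -/
def commNode {n : ℕ} (v : D.commStage n) : D.stage n := ⟨v, commStage_mem v⟩

theorem commNode_injective {n : ℕ} :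
    Function.Injective (commNode : D.commStage n → D.stage n) := fun u v h => by
  have := congrArg Subtype.val h
  exact Subtype.ext this

open Classical in
theorem initProb_update (ch : PosetCausalChannel D X Y) {n : ℕ} (v : D.commStage n)
    (y : D.stage n → Y) (b : Y) :
    ch.initProb (Function.update y (commNode v) b) = ch.initProb y := by
  have key : ∀ (u : D.Init) (hu : (u : V) ∈ D.stage n),
      Function.update y (commNode v) b ⟨u, hu⟩ = y ⟨u, hu⟩ := by
    refine fun u hu => Function.update_of_ne (fun h => ?_) _ _
    have h' : (u : V) = v := congrArg Subtype.val h
    exact u.2 (h' ▸ (D.mem_commStage.1 v.2).2)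
  simp only [initProb, key]

open Classical in
/-- Each assignment of outputs to the initial nodes is counted once for every assignment of outputs
to the communication nodes. -/
theorem sum_initProb [DiscreteMeasurableSpace Y] (ch : PosetCausalChannel D X Y) (n : ℕ) :
    ∑ y : D.stage n → Y, ch.initProb y = (Fintype.card Y : ℝ) ^ (D.commStage n).card := by
  classical
  let p : D.stage n → Prop := fun v => (v : V) ∈ D.comm
  let e := Equiv.piEquivPiSubtypeProd p (fun _ => Y)
  let T : (D.Init → Y) → ({v // ¬ p v} → Y) := fun ω v => ω ⟨v.1, v.2⟩
  have hT : Measurable T := measurable_pi_lambda _ fun v => measurable_pi_apply _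
  have := ch.initLaw_prob
  have h1 : ∀ x, ch.initProb (e.symm x) = ch.initLaw.real (T ⁻¹' {x.2}) := by
    rintro ⟨x1, x2⟩
    unfold initProb
    congr 1
    ext ω
    simp only [Set.mem_ofPred_eq, Set.mem_preimage, Set.mem_singleton_iff]
    constructor
    · intro h
      ext v
      rw [show T ω v = ω ⟨v.1, v.2⟩ from rfl, h ⟨v.1, v.2⟩ v.1.2]
      simp [e, Equiv.piEquivPiSubtypeProd, v.2]
    · rintro h v hv
      have := congrFun h ⟨⟨v, hv⟩, v.2⟩
      rw [show T ω _ = ω ⟨v.1, v.2⟩ from rfl] at this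
      rw [this]
      have hv2 : ¬ p ⟨v, hv⟩ := v.2
      simp [e, Equiv.piEquivPiSubtypeProd, hv2]
  rw [← e.symm.sum_comp, Fintype.sum_prod_type]
  simp_rw [h1]
  rw [sum_measureReal_preimage_singleton _ fun z _ => hT (measurableSet_singleton z)]
  have hcard : Fintype.card {v // p v} = (D.commStage n).card := by
    rw [← Fintype.card_coe]
    exact (Fintype.card_congr (Equiv.ofBijective
      (fun v : D.commStage n => (⟨commNode v, (D.mem_commStage.1 v.2).2⟩ : {v // p v}))
      ⟨fun u v h => commNode_injective (congrArg Subtype.val h), fun v =>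
        ⟨⟨v.1, D.mem_commStage.2 ⟨v.1.2, v.2⟩⟩, rfl⟩⟩)).symm
  simp [hcard]

end PosetCausalChannel

/-! ### The local laws of a code -/

namespace PosetMarkovChannel

open PosetCausalChannel

variable {V : Type*} {D : ChannelDAG V} {X Y : Type*} {n M : ℕ}

open Classical in
theorem pastOutputs_update {y : D.stage n → Y} {u : D.stage n} {v : V} (hv : v ∈ D.stage n)
    (b : Y) (h : ¬ D.Prec u v) :
    pastOutputs (Function.update y u b) v hv = pastOutputs y v hv := by
  ext t
  refine Function.update_of_ne (fun e => h ?_) _ _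
  have := congrArg Subtype.val e
  exact this ▸ t.2

/-- The outputs at the parents of `v`. -/
def parentOutputs (y : D.stage n → Y) (v : D.commStage n) : D.parents v → Y :=
  fun u => pastOutputs y v (commStage_mem v) (D.parentToPast u)

/-- The input at `v` that the encoder produces from the message `w` and the outputs `y`. -/
def codeInput (f : Encoder D X Y n M) (w : Fin M) (y : D.stage n → Y) (v : D.commStage n) : X :=
  f v w (pastOutputs y v (commStage_mem v))

open Classical in
theorem codeInput_update (f : Encoder D X Y n M) (w : Fin M) {y : D.stage n → Y} {u : D.stage n}
    {v : D.commStage n} (b : Y) (h : ¬ D.Prec u v) :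
    codeInput f w (Function.update y u b) v = codeInput f w y v := by
  rw [codeInput, pastOutputs_update _ _ h]; rfl

open Classical in
theorem parentOutputs_update {y : D.stage n → Y} {u : D.stage n} {v : D.commStage n} (b : Y)
    (h : ¬ D.Prec u v) :
    parentOutputs (Function.update y u b) v = parentOutputs y v := by
  ext t
  rw [parentOutputs, pastOutputs_update _ _ h]; rfl

variable [Fintype Y] [MeasurableSpace Y] (ch : PosetMarkovChannel D X Y)

/-- The transition law at a communication node of stage `n`. -/
def nodeKernel (v : D.commStage n) : X → (D.parents v → Y) → Y → ℝ := ch.localKernel (D.toComm v)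

theorem kernel_eq (f : Encoder D X Y n M) (w : Fin M) (y : D.stage n → Y) (v : D.commStage n)
    (b : Y) :
    ch.kernel (D.toComm v) (pastInputs f w y v (commStage_mem v))
      (pastOutputs y v (commStage_mem v)) b =
    ch.nodeKernel v (codeInput f w y v) (parentOutputs y v) b :=
  ch.markov (D.toComm v) _ _ b

theorem outputProb_eq (f : Encoder D X Y n M) (w : Fin M) (y : D.stage n → Y) :
    ch.outputProb f w y = ch.initProb y * ∏ v : D.commStage n,
      ch.nodeKernel v (codeInput f w y v) (parentOutputs y v) (y (commNode v)) := by
  simp_rw [← kernel_eq]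
  rfl

theorem sum_localKernel_code (f : Encoder D X Y n M) (w : Fin M) (y : D.stage n → Y)
    (v : D.commStage n) :
    ∑ b, ch.nodeKernel v (codeInput f w y v) (parentOutputs y v) b = 1 := by
  simp_rw [← kernel_eq]
  exact ch.kernel_sum _ _ _

theorem outputProb_nonneg (f : Encoder D X Y n M) (w : Fin M) (y : D.stage n → Y) :
    0 ≤ ch.outputProb f w y :=
  mul_nonneg measureReal_nonneg (Finset.prod_nonneg fun _ _ => ch.kernel_nonneg _ _ _ _)

theorem stage_prec_trans (u v w : D.stage n) (h : D.Prec u v) (h' : D.Prec v w) : D.Prec u w :=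
  Relation.TransGen.trans h h'

open Classical in
/-- The laws built on stage `n` from transition laws that look at the preceding outputs only have
total mass one. -/
theorem sum_initProb_mul_prod [Nonempty Y] [DiscreteMeasurableSpace Y]
    (κ : D.commStage n → (D.stage n → Y) → Y → ℝ)
    (hκ : ∀ (v : D.commStage n) (u : D.stage n) y b, ¬ D.Prec u v →
      κ v (Function.update y u b) = κ v y) (hκ1 : ∀ v y, ∑ b, κ v y b = 1) :
    ∑ y : D.stage n → Y, ch.initProb y * ∏ v, κ v y (y (commNode v)) = 1 := by
  have h := sum_causal_finset (R := fun u v : D.stage n => D.Prec u v) (j := commNode)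
    stage_prec_trans (fun u => D.acyclic u) commNode_injective
    (fun v y b => ch.initProb_update v y b) hκ hκ1 Finset.univ
  rw [ch.sum_initProb, Finset.card_univ, Fintype.card_coe] at h
  exact mul_left_cancel₀ (by positivity) (h.trans (mul_one _).symm)

open Classical in
/-- The expectation of a function of the message and the outputs, under a code. -/
noncomputable def codeMean (f : Encoder D X Y n M) (F : Fin M → (D.stage n → Y) → ℝ) : ℝ :=
  (∑ w : Fin M, ∑ y : D.stage n → Y, ch.outputProb f w y * F w y) / M

theorem codeMean_mono (f : Encoder D X Y n M) {F F' : Fin M → (D.stage n → Y) → ℝ}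
    (h : ∀ w y, F w y ≤ F' w y) : ch.codeMean f F ≤ ch.codeMean f F' := by
  unfold codeMean
  gcongr
  exacts [ch.outputProb_nonneg f _ _, h _ _]

theorem codeMean_sum {J : Type*} (f : Encoder D X Y n M) (t : Finset J)
    (F : J → Fin M → (D.stage n → Y) → ℝ) :
    ch.codeMean f (fun w y => ∑ j ∈ t, F j w y) = ∑ j ∈ t, ch.codeMean f (F j) := by
  unfold codeMean
  rw [← Finset.sum_div]
  congr 1
  simp_rw [Finset.mul_sum]
  rw [Finset.sum_congr rfl fun w _ => Finset.sum_comm, Finset.sum_comm]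

theorem codeMean_mul_const (f : Encoder D X Y n M) (F : Fin M → (D.stage n → Y) → ℝ) (c : ℝ) :
    ch.codeMean f (fun w y => F w y * c) = ch.codeMean f F * c := by
  unfold codeMean
  simp_rw [← mul_assoc, ← Finset.sum_mul]
  ring

theorem codeMean_sub (f : Encoder D X Y n M) (F F' : Fin M → (D.stage n → Y) → ℝ) :
    ch.codeMean f (fun w y => F w y - F' w y) = ch.codeMean f F - ch.codeMean f F' := by
  unfold codeMean
  simp_rw [mul_sub, Finset.sum_sub_distrib, sub_div]

theorem sum_outputProb [Nonempty Y] [DiscreteMeasurableSpace Y] (f : Encoder D X Y n M)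
    (w : Fin M) : open Classical in ∑ y : D.stage n → Y, ch.outputProb f w y = 1 := by
  simp_rw [outputProb_eq]
  refine ch.sum_initProb_mul_prod (fun v y b =>
    ch.nodeKernel v (codeInput f w y v) (parentOutputs y v) b) ?_
    fun v y => ch.sum_localKernel_code f w y v
  intro v u y b h
  ext c
  rw [codeInput_update f w b h, parentOutputs_update b h]

theorem codeMean_one [Nonempty Y] [DiscreteMeasurableSpace Y] (hM : M ≠ 0)
    (f : Encoder D X Y n M) : ch.codeMean f (fun _ _ => 1) = 1 := by
  classical
  unfold codeMean
  simp_rw [mul_one, sum_outputProb]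
  simp [hM]

/-- The output at `v` is generated by the transition law at `v`. -/
theorem codeMean_mul_indicator [Nonempty Y] (f : Encoder D X Y n M) (v : D.commStage n)
    (G : X → (D.parents v → Y) → ℝ) (b : Y) : open Classical in
    ch.codeMean f (fun w y => G (codeInput f w y v) (parentOutputs y v) *
      if y (commNode v) = b then 1 else 0) =
    ch.codeMean f (fun w y => G (codeInput f w y v) (parentOutputs y v) *
      ch.nodeKernel v (codeInput f w y v) (parentOutputs y v) b) := by
  classical
  unfold codeMean
  congr 1
  refine Finset.sum_congr rfl fun w _ => ?_
  simp_rw [outputProb_eq]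
  convert sum_causal_mul_indicator (R := fun u v : D.stage n => D.Prec u v) (j := commNode)
    (κ := fun v y b =>
      ch.nodeKernel v (codeInput f w y v) (parentOutputs y v) b)
    stage_prec_trans (fun u => D.acyclic u) commNode_injective
    (fun v y b => ch.initProb_update v y b) ?_ (fun v y => ch.sum_localKernel_code f w y v) v
    (fun y => G (codeInput f w y v) (parentOutputs y v)) ?_ b
  · intro v u y b h
    ext c
    have h' : ¬ D.Prec u v := h
    rw [codeInput_update f w b h', parentOutputs_update b h']
  · intro u y b h
    have h' : ¬ D.Prec u v := h
    rw [codeInput_update f w b h', parentOutputs_update b h']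

open Classical in
/-- The joint law of the input at `v` and of the outputs at the parents of `v`, under a code. -/
noncomputable def codeLaw (f : Encoder D X Y n M) : LocalLaws D X Y n := fun v x z =>
  ch.codeMean f fun w y => if codeInput f w y v = x ∧ parentOutputs y v = z then 1 else 0

theorem codeLaw_nonneg (f : Encoder D X Y n M) (v : D.commStage n) (x : X) (z : D.parents v → Y) :
    0 ≤ ch.codeLaw f v x z := by
  refine le_trans ?_ (ch.codeMean_mono f (F := fun _ _ => 0) fun w y => ?_)
  · simp [codeMean]
  · split_ifs <;> norm_num

variable [Fintype X]

theorem sum_codeLaw_mul (f : Encoder D X Y n M) (v : D.commStage n)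
    [Fintype (D.parents v → Y)] (G : X → (D.parents v → Y) → ℝ) :
    ∑ x, ∑ z, ch.codeLaw f v x z * G x z =
      ch.codeMean f fun w y => G (codeInput f w y v) (parentOutputs y v) := by
  classical
  unfold codeLaw
  simp_rw [← codeMean_mul_const, ← codeMean_sum]
  congr 1
  ext w y
  rw [Finset.sum_eq_single (codeInput f w y v), Finset.sum_eq_single (parentOutputs y v)]
  · simp
  · intro z _ h
    simp [h.symm]
  · simp
  · intro x _ h
    simp [h.symm]
  · simp

/-- The joint law of the input at `v`, of the outputs at the parents of `v` and of the output at
`v`, under a code. -/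
theorem sum_codeLaw_mul_localKernel [Nonempty Y] (f : Encoder D X Y n M) (v : D.commStage n)
    [Fintype (D.parents v → Y)] (G : X → (D.parents v → Y) → ℝ) (b : Y) : open Classical in
    ∑ x, ∑ z, ch.codeLaw f v x z * ch.nodeKernel v x z b * G x z =
      ch.codeMean f fun w y => G (codeInput f w y v) (parentOutputs y v) *
        if y (commNode v) = b then 1 else 0 := by
  classical
  rw [codeMean_mul_indicator, ← sum_codeLaw_mul ch f v
    (fun x z => G x z * ch.nodeKernel v x z b)]
  exact Finset.sum_congr rfl fun x _ => Finset.sum_congr rfl fun z _ => by ring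

theorem tupleMarginal_codeLaw {J : Type*} (f : Encoder D X Y n M) (v : D.commStage n)
    (r : J → D.parents v) (z : J → Y) : open Classical in
    tupleMarginal (ch.codeLaw f v) r z =
      ch.codeMean f fun _ y => if (fun j => parentOutputs y v (r j)) = z then 1 else 0 := by
  classical
  rw [tupleMarginal_eq_outputLaw, outputLaw, sum_codeLaw_mul]
  rfl

theorem isLocallyConsistent_codeLaw [Nonempty Y] [DiscreteMeasurableSpace Y] (hM : M ≠ 0)
    (f : Encoder D X Y n M) : ch.IsLocallyConsistent n (ch.codeLaw f) where
  law v := by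
    classical
    refine ⟨ch.codeLaw_nonneg f v, ?_⟩
    have := ch.sum_codeLaw_mul f v fun _ _ => 1
    simp_rw [mul_one] at this
    rw [this, ch.codeMean_one hM]
  channel v u h b := by
    classical
    change outputLaw (ch.nodeKernel v) _ _ = _
    have := ch.sum_codeLaw_mul_localKernel f v (fun _ _ => 1) b
    simp_rw [mul_one, one_mul] at this
    rw [outputLaw, this, tupleMarginal_codeLaw]
    congr 1
    ext w y
    congr 1
    rw [funext_iff]
    simp only [forall_const, eq_iff_iff]
    rfl
  overlap u v z := by
    rw [tupleMarginal_codeLaw, tupleMarginal_codeLaw]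
    rfl

/-! ### Fano's inequality for codes with feedback -/

theorem sum_channelInfo_codeLaw [Nonempty Y] (x₀ : X)
    (hW : ∀ (v : D.commStage n) x z b, 0 < ch.nodeKernel v x z b)
    (hW1 : ∀ (v : D.commStage n) x z, ∑ b, ch.nodeKernel v x z b = 1) (f : Encoder D X Y n M) :
    open Classical in
    ∑ v, channelInfo (ch.nodeKernel v) (ch.codeLaw f v) =
      ch.codeMean f fun w y => ∑ v : D.commStage n, Real.log
        (ch.nodeKernel v (codeInput f w y v) (parentOutputs y v) (y (commNode v)) /
          outputCond (ch.nodeKernel v) x₀ (ch.codeLaw f v) (parentOutputs y v)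
            (y (commNode v))) := by
  classical
  rw [codeMean_sum]
  refine Finset.sum_congr rfl fun v _ => ?_
  rw [channelInfo_eq_outputCond (hW _) (hW1 _) (ch.codeLaw_nonneg f v) x₀,
    Finset.sum_comm]
  have := fun b => ch.sum_codeLaw_mul_localKernel f v
    (fun x z => Real.log (ch.nodeKernel v x z b /
      outputCond (ch.nodeKernel v) x₀ (ch.codeLaw f v) z b)) b
  simp_rw [this, ← codeMean_sum]
  congr 1
  ext w y
  simp

/-- Fano's inequality: the message size is bounded by the sum of the local informations. The law of
the message and the outputs is compared with the one under which the message is independent of the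
outputs, and the latter follow their local conditional laws given the outputs of the parents. -/
theorem log_messages_le [Nonempty X] [Nonempty Y] [DiscreteMeasurableSpace Y]
    (hW : ∀ (v : D.commStage n) x z b, 0 < ch.nodeKernel v x z b)
    (hW1 : ∀ (v : D.commStage n) x z, ∑ b, ch.nodeKernel v x z b = 1) (hM : M ≠ 0)
    (f : Encoder D X Y n M)
    (g : (D.commStage n → Y) → Fin M) {ε : ℝ} (hε : 0 < ε) (hε1 : ε < 1)
    (h : ch.errorProb f g ≤ ε) : open Classical in
    (1 - ε) * Real.log M ≤
      ∑ v, channelInfo (ch.nodeKernel v) (ch.codeLaw f v) +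
        (-Real.log (1 - ε) - ε * Real.log ε) := by
  classical
  obtain ⟨x₀⟩ := ‹Nonempty X›
  have hM0 : (0 : ℝ) < M := by positivity
  set q := fun v : D.commStage n =>
    outputCond (ch.nodeKernel v) x₀ (ch.codeLaw f v) with hq
  have hqpos : ∀ v z b, 0 < q v z b := fun v =>
    outputCond_pos (hW _) (ch.codeLaw_nonneg f v) x₀
  -- weights for success and failure, whose sum over the messages is at most `M` for any output
  set l : Fin M → (D.stage n → Y) → ℝ := fun w y =>
    if g (commOutputs y) ≠ w then ε else M * (1 - ε) with hl
  have hlpos : ∀ w y, 0 < l w y := by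
    intro w y
    simp only [hl]
    split_ifs
    exacts [hε, mul_pos hM0 (by linarith)]
  have hsum : ∀ y, ∑ w, l w y ≤ M := by
    intro y
    have : ∀ w, l w y ≤ ε + if g (commOutputs y) = w then M * (1 - ε) else 0 := by
      intro w
      simp only [hl]
      split_ifs <;> simp_all; linarith
    refine (Finset.sum_le_sum fun w _ => this w).trans_eq ?_
    simp [Finset.sum_add_distrib]
    ring
  set W : Fin M → (D.stage n → Y) → D.commStage n → ℝ := fun w y v =>
    ch.nodeKernel v (codeInput f w y v) (parentOutputs y v) (y (commNode v)) with hWdef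
  have hWpos : ∀ w y v, 0 < W w y v := fun w y v => hW _ _ _ _
  set q' : (D.stage n → Y) → D.commStage n → ℝ := fun y v =>
    q v (parentOutputs y v) (y (commNode v)) with hq'
  have hqpos' : ∀ y v, 0 < q' y v := fun y v => hqpos _ _ _
  rw [ch.sum_channelInfo_codeLaw x₀ hW hW1 f]
  change _ ≤ (ch.codeMean f fun w y => ∑ v, Real.log (W w y v / q' y v)) + _
  -- `log t ≤ t - 1` for `t` the weight times the likelihood ratio of the comparison law
  have h1 : ch.codeMean f (fun w y => Real.log (l w y)) ≤
      ch.codeMean f fun w y => ∑ v, Real.log (W w y v / q' y v) := by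
    have h2 : ∀ w y, Real.log (l w y) - ∑ v, Real.log (W w y v / q' y v) ≤
        l w y * ∏ v, (q' y v / W w y v) - 1 := by
      intro w y
      have hp : 0 < ∏ v, (q' y v / W w y v) :=
        Finset.prod_pos fun v _ => div_pos (hqpos' y v) (hWpos w y v)
      refine le_trans (le_of_eq ?_) (Real.log_le_sub_one_of_pos (mul_pos (hlpos w y) hp))
      rw [Real.log_mul (hlpos w y).ne' hp.ne',
        Real.log_prod fun v _ => (div_pos (hqpos' y v) (hWpos w y v)).ne', sub_eq_add_neg,
        ← Finset.sum_neg_distrib]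
      congr 1
      refine Finset.sum_congr rfl fun v _ => ?_
      rw [← Real.log_inv, inv_div]
    have h3 : ch.codeMean f (fun w y => l w y * ∏ v, (q' y v / W w y v)) ≤ 1 := by
      unfold codeMean
      have h4 : ∀ w y, ch.outputProb f w y * (l w y * ∏ v, (q' y v / W w y v)) =
          (ch.initProb y * ∏ v, q' y v) * l w y := by
        intro w y
        rw [outputProb_eq, Finset.prod_div_distrib]
        change ch.initProb y * (∏ v, W w y v) * _ = _
        have := (Finset.prod_pos fun v (_ : v ∈ Finset.univ) => hWpos w y v).ne'
        field_simp
      simp_rw [h4]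
      rw [Finset.sum_comm, div_le_one hM0]
      simp_rw [← Finset.mul_sum]
      refine (Finset.sum_le_sum fun y _ => mul_le_mul_of_nonneg_left (hsum y)
        (mul_nonneg measureReal_nonneg (Finset.prod_nonneg fun v _ => (hqpos' y v).le))).trans_eq ?_
      rw [← Finset.sum_mul]
      have := ch.sum_initProb_mul_prod (fun v y b => q v (parentOutputs y v) b)
        (fun v u y b hu => by rw [parentOutputs_update b hu])
        (fun v y => sum_outputCond (hW1 _) x₀ _)
      exact (congrArg (· * (M : ℝ)) this).trans (one_mul _)
    have h5 := ch.codeMean_mono f h2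
    rw [codeMean_sub, codeMean_sub, ch.codeMean_one hM] at h5
    linarith
  have h6 : ch.codeMean f (fun w y => Real.log (l w y)) =
      Real.log (M * (1 - ε)) - ch.errorProb f g * (Real.log (M * (1 - ε)) - Real.log ε) := by
    have e1 : ch.errorProb f g =
        ch.codeMean f fun w y => if g (commOutputs y) ≠ w then 1 else 0 := by
      unfold errorProb codeMean
      simp_rw [mul_ite, mul_one, mul_zero]
    have e2 : (fun w y => Real.log (l w y)) = fun w y => 1 * Real.log (M * (1 - ε)) -
        (if g (commOutputs y) ≠ w then 1 else 0) * (Real.log (M * (1 - ε)) - Real.log ε) := by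
      ext w y
      simp only [hl]
      split_ifs <;> ring
    rw [e2, codeMean_sub, codeMean_mul_const, codeMean_mul_const, ch.codeMean_one hM, e1, one_mul]
  have he : 0 ≤ ch.errorProb f g := by
    unfold errorProb
    refine div_nonneg (Finset.sum_nonneg fun w _ => Finset.sum_nonneg fun y _ => ?_) hM0.le
    split_ifs
    exacts [ch.outputProb_nonneg f w y, le_rfl]
  rw [Real.log_mul hM0.ne' (by linarith)] at h6
  have a1 : Real.log (1 - ε) ≤ 0 := Real.log_nonpos (by linarith) (by linarith)
  have a2 : Real.log ε ≤ 0 := Real.log_nonpos hε.le hε1.le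
  have a3 : 0 ≤ Real.log M := Real.log_natCast_nonneg M
  nlinarith [mul_nonneg (sub_nonneg.2 h) a3, mul_nonneg he (neg_nonneg.2 a1),
    mul_nonneg (sub_nonneg.2 h) (neg_nonneg.2 a2)]

end PosetMarkovChannel

/-! ### Translations of a stage of the Cayley graph -/

namespace ChannelDAG

open Classical in
/-- The communication nodes `v` of stage `n` whose translate `ι v * g` is not a communication node
of stage `n`. -/
noncomputable def shiftDefect {V G : Type*} [Group G] (D : ChannelDAG V) (ι : V → G) (n : ℕ)
    (g : G) : Finset (D.commStage n) :=
  Finset.univ.filter fun v => ¬ ∃ u : D.commStage n, ι v * g = ι u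

open Classical in
/-- The communication node of stage `n` at `ι v * g` if there is one, and `v` otherwise. -/
noncomputable def shiftNode {V G : Type*} [Group G] (D : ChannelDAG V) (ι : V → G) {n : ℕ}
    (g : G) (v : D.commStage n) : D.commStage n :=
  if h : ∃ u : D.commStage n, ι v * g = ι u then h.choose else v

variable {V G : Type*} [Group G] {D : ChannelDAG V} {ι : V → G} {n : ℕ}

theorem mem_shiftDefect {g : G} {v : D.commStage n} :
    v ∈ D.shiftDefect ι n g ↔ ¬ ∃ u : D.commStage n, ι v * g = ι u := by
  simp [shiftDefect]

theorem shiftNode_spec {g : G} {v : D.commStage n} (h : v ∉ D.shiftDefect ι n g) :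
    ι v * g = ι (D.shiftNode ι g v) := by
  have h' := not_not.1 (mt mem_shiftDefect.2 h)
  rw [shiftNode, dif_pos h']
  exact h'.choose_spec

theorem shiftNode_notMem {g : G} {v : D.commStage n} (h : v ∉ D.shiftDefect ι n g) :
    D.shiftNode ι g v ∉ D.shiftDefect ι n g⁻¹ := by
  rw [mem_shiftDefect, not_not]
  exact ⟨v, by rw [← shiftNode_spec h, mul_inv_cancel_right]⟩

theorem shiftNode_inv (hι : Function.Injective ι) {g : G} {v : D.commStage n}
    (h : v ∉ D.shiftDefect ι n g) : D.shiftNode ι g⁻¹ (D.shiftNode ι g v) = v := by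
  refine Subtype.ext (hι ?_)
  rw [← shiftNode_spec (shiftNode_notMem h), ← shiftNode_spec h, mul_inv_cancel_right]

/-- Translation by `g` matches all but the defects of `g` and of `g⁻¹`. -/
theorem sum_compl_shiftDefect (hι : Function.Injective ι) (g : G) {α β : D.commStage n → ℝ}
    (h : ∀ u v : D.commStage n, ι v * g = ι u → α v = β u) : open Classical in
    ∑ v ∈ (D.shiftDefect ι n g)ᶜ, α v = ∑ u ∈ (D.shiftDefect ι n g⁻¹)ᶜ, β u := by
  classical
  refine Finset.sum_nbij' (D.shiftNode ι g) (D.shiftNode ι g⁻¹) ?_ ?_ ?_ ?_ ?_ <;>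
    simp only [Finset.mem_compl]
  · exact fun v hv => shiftNode_notMem hv
  · intro u hu
    simpa using shiftNode_notMem hu
  · exact fun v hv => shiftNode_inv hι hv
  · intro u hu
    simpa using shiftNode_inv hι hu
  · exact fun v hv => h _ _ (shiftNode_spec hv)

theorem card_shiftDefect_inv (hι : Function.Injective ι) (g : G) :
    (D.shiftDefect ι n g⁻¹).card = (D.shiftDefect ι n g).card := by
  classical
  have := sum_compl_shiftDefect (D := D) (n := n) hι g (α := fun _ => 1) (β := fun _ => 1)
    fun _ _ _ => rfl
  simp only [Finset.sum_const, nsmul_eq_mul, mul_one, Nat.cast_inj] at this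
  have h1 := Finset.card_add_card_compl (D.shiftDefect ι n g)
  have h2 := Finset.card_add_card_compl (D.shiftDefect ι n g⁻¹)
  omega

theorem card_shiftDefect_mul_le (hι : Function.Injective ι) (g h : G) :
    (D.shiftDefect ι n (g * h)).card ≤
      (D.shiftDefect ι n g).card + (D.shiftDefect ι n h).card := by
  classical
  have h1 : ((D.shiftDefect ι n (g * h)) \ (D.shiftDefect ι n g)).card ≤
      (D.shiftDefect ι n h).card := by
    refine Finset.card_le_card_of_injOn (D.shiftNode ι g) ?_ ?_
    · intro v hv
      have hv := Finset.mem_sdiff.1 (Finset.mem_coe.1 hv)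
      rw [Finset.mem_coe, mem_shiftDefect]
      rintro ⟨u, hu⟩
      rw [← shiftNode_spec hv.2, mul_assoc] at hu
      exact mem_shiftDefect.1 hv.1 ⟨u, hu⟩
    · intro v hv w hw e
      rw [← shiftNode_inv hι (Finset.mem_sdiff.1 (Finset.mem_coe.1 hv)).2, e,
        shiftNode_inv hι (Finset.mem_sdiff.1 (Finset.mem_coe.1 hw)).2]
  have h2 := Finset.card_le_card_sdiff_add_card (s := D.shiftDefect ι n (g * h))
    (t := D.shiftDefect ι n g)
  omega

theorem abs_sum_sub_sum_le_shiftDefect (hι : Function.Injective ι) (g : G)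
    {α β : D.commStage n → ℝ}
    (h : ∀ u v : D.commStage n, ι v * g = ι u → α v = β u) (hα : ∀ v, 0 ≤ α v)
    (hα1 : ∀ v, α v ≤ 1) (hβ : ∀ v, 0 ≤ β v) (hβ1 : ∀ v, β v ≤ 1) :
    |∑ v, α v - ∑ u, β u| ≤ (D.shiftDefect ι n g).card := by
  classical
  have h0 := sum_compl_shiftDefect hι g h
  rw [← Finset.sum_add_sum_compl (D.shiftDefect ι n g),
    ← Finset.sum_add_sum_compl (D.shiftDefect ι n g⁻¹) β, h0, add_sub_add_right_eq_sub]
  have a1 : ∑ v ∈ D.shiftDefect ι n g, α v ≤ (D.shiftDefect ι n g).card := by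
    simpa using Finset.sum_le_sum fun v (_ : v ∈ D.shiftDefect ι n g) => hα1 v
  have a2 : ∑ v ∈ D.shiftDefect ι n g⁻¹, β v ≤ (D.shiftDefect ι n g).card := by
    rw [← card_shiftDefect_inv hι]
    simpa using Finset.sum_le_sum fun v (_ : v ∈ D.shiftDefect ι n g⁻¹) => hβ1 v
  have a3 := Finset.sum_nonneg fun v (_ : v ∈ D.shiftDefect ι n g) => hα v
  have a4 := Finset.sum_nonneg fun v (_ : v ∈ D.shiftDefect ι n g⁻¹) => hβ v
  exact abs_sub_le_iff.2 ⟨by linarith, by linarith⟩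

end ChannelDAG

/-! ### Local laws and laws of tuples -/

namespace PosetMarkovChannel.IsApproxSymmetric

variable {V : Type*} {D : ChannelDAG V} {X Y : Type*} [Fintype Y] [MeasurableSpace Y]
  {ch : PosetMarkovChannel D X Y} {G : Type*} [Group G] {d : ℕ} {s : Fin d → G} {ι : V → G}
  {Q : X → (Fin d → Y) → Y → ℝ} {n : ℕ}

/-- A communication node has `d` parents, and different parents are reached by different generators,
so that all the generators occur. -/
theorem exists_parentEquiv (hsym : ch.IsApproxSymmetric s ι Q) {v : V} (hv : v ∈ D.comm) :
    ∃ e : D.parents v ≃ Fin d, ∀ u : D.parents v, ι u * s (e u) = ι v := by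
  choose r hr using fun u : D.parents v => (hsym.induced u v).1 (D.mem_parents.1 u.2)
  have hinj : Function.Injective r := by
    intro u w h
    refine Subtype.ext (hsym.embedding (mul_right_cancel (b := s (r u)) ?_))
    rw [hr, h, hr]
  have hbij : Function.Bijective r := (Fintype.bijective_iff_injective_and_card r).2
    ⟨hinj, by rw [Fintype.card_coe, hsym.in_degree v hv, Fintype.card_fin]⟩
  exact ⟨Equiv.ofBijective r hbij, hr⟩

/-- A node with `d` children in the stage has a child along each generator, and the children of a
communication node are communication nodes. -/
theorem card_shiftDefect_le_boundary (hsym : ch.IsApproxSymmetric s ι Q) (i : Fin d) :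
    (D.shiftDefect ι n (s i)).card ≤ (D.boundary d n).card := by
  classical
  refine Finset.card_le_card_of_injOn Subtype.val ?_ Subtype.val_injective.injOn
  intro v hv
  by_contra hb
  refine ChannelDAG.mem_shiftDefect.1 (Finset.mem_coe.1 hv) ?_
  simp only [ChannelDAG.boundary, Finset.coe_filter, Set.mem_ofPred_eq, not_and, not_or,
    not_lt] at hb
  have hd := (hb (PosetCausalChannel.commStage_mem v)).2
  set T := (D.stage n).filter fun w => D.Edge v w with hT
  choose r hr using fun w : T => (hsym.induced v w).1 (Finset.mem_filter.1 w.2).2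
  have hinj : Function.Injective r := by
    intro u w h
    refine Subtype.ext (hsym.embedding ?_)
    rw [← hr, h, hr]
  have hbij : Function.Bijective r := (Fintype.bijective_iff_injective_and_card r).2
    ⟨hinj, le_antisymm (Fintype.card_le_of_injective r hinj) (by simpa using hd)⟩
  obtain ⟨w, hw⟩ := hbij.2 i
  have hw' := Finset.mem_filter.1 w.2
  refine ⟨⟨w, D.mem_commStage.2 ⟨hw'.1, ?_⟩⟩, by rw [← hw]; exact hr w⟩
  by_contra hc
  exact D.no_edge_comm_init v w (D.mem_commStage.1 v.2).2 hc hw'.2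

theorem law_le_one (hsym : ch.IsApproxSymmetric s ι Q) (x : X) (z : Fin d → Y) (b : Y) :
    Q x z b ≤ 1 := by
  rw [← hsym.law_sum x z]
  exact Finset.single_le_sum (f := fun b => Q x z b) (fun b _ => (hsym.law_pos x z b).le)
    (Finset.mem_univ b)

variable (hsym : ch.IsApproxSymmetric s ι Q)

/-- The numbering of the parents of a communication node by the generators. -/
noncomputable def parentEquiv (v : D.commStage n) : D.parents v ≃ Fin d :=
  (hsym.exists_parentEquiv (D.mem_commStage.1 v.2).2).choose

theorem parentEquiv_spec (v : D.commStage n) (u : D.parents v) :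
    ι u * s (hsym.parentEquiv v u) = ι v :=
  (hsym.exists_parentEquiv (D.mem_commStage.1 v.2).2).choose_spec u

theorem parentEquiv_symm_spec (v : D.commStage n) (i : Fin d) :
    ι ((hsym.parentEquiv v).symm i) = ι v * (s i)⁻¹ := by
  have := hsym.parentEquiv_spec v ((hsym.parentEquiv v).symm i)
  rw [Equiv.apply_symm_apply] at this
  rw [← this, mul_inv_cancel_right]

theorem nodeKernel_eq (v : D.commStage n) (x : X) (y : D.parents v → Y) (b : Y) :
    ch.nodeKernel v x y b = Q x (fun i => y ((hsym.parentEquiv v).symm i)) b := by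
  refine hsym.stationary (D.toComm v) x y _ (fun i u hu => ?_) b
  congr 1
  refine Subtype.ext (hsym.embedding ?_)
  exact (eq_mul_inv_of_mul_eq hu).trans (hsym.parentEquiv_symm_spec v i).symm

theorem nodeKernel_pos (hsym : ch.IsApproxSymmetric s ι Q) (v : D.commStage n) (x : X)
    (z : D.parents v → Y) (b : Y) : 0 < ch.nodeKernel v x z b := by
  rw [hsym.nodeKernel_eq]
  exact hsym.law_pos _ _ _

theorem sum_nodeKernel (hsym : ch.IsApproxSymmetric s ι Q) (v : D.commStage n) (x : X)
    (z : D.parents v → Y) : ∑ b, ch.nodeKernel v x z b = 1 := by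
  simp_rw [hsym.nodeKernel_eq]
  exact hsym.law_sum _ _

/-- The law of the input and of the tuple of outputs of the parents, from a local law at `v`. -/
noncomputable def tupleLaw (v : D.commStage n) (p : X → (D.parents v → Y) → ℝ) :
    X → (Fin d → Y) → ℝ :=
  fun x z => p x fun u => z (hsym.parentEquiv v u)

/-- The local law at `v` whose tuple law is `p`. -/
noncomputable def localLaw (p : X → (Fin d → Y) → ℝ) (v : D.commStage n) :
    X → (D.parents v → Y) → ℝ :=
  fun x y => p x fun i => y ((hsym.parentEquiv v).symm i)

theorem tupleLaw_localLaw (p : X → (Fin d → Y) → ℝ) (v : D.commStage n) :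
    hsym.tupleLaw v (hsym.localLaw p v) = p := by
  ext x z
  simp [tupleLaw, localLaw]

variable [Fintype X]

theorem outputLaw_tupleLaw (v : D.commStage n) [Fintype (D.parents v → Y)]
    (p : X → (D.parents v → Y) → ℝ) (b : Y) :
    outputLaw Q (hsym.tupleLaw v p) b = outputLaw (ch.nodeKernel v) p b := by
  rw [← outputLaw_reindex ((hsym.parentEquiv v).symm.arrowCongr (Equiv.refl Y))]
  congr 1
  ext x z b
  rw [hsym.nodeKernel_eq]
  simp

theorem channelInfo_tupleLaw (v : D.commStage n) [Fintype (D.parents v → Y)]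
    (p : X → (D.parents v → Y) → ℝ) :
    channelInfo Q (hsym.tupleLaw v p) = channelInfo (ch.nodeKernel v) p := by
  rw [← channelInfo_reindex ((hsym.parentEquiv v).symm.arrowCongr (Equiv.refl Y))]
  congr 1
  ext x z b
  rw [hsym.nodeKernel_eq]
  simp

theorem isFinLaw_tupleLaw (v : D.commStage n) [Fintype (D.parents v → Y)]
    {p : X → (D.parents v → Y) → ℝ} (hp : IsFinLaw p) : IsFinLaw (hsym.tupleLaw v p) :=
  hp.reindex ((hsym.parentEquiv v).symm.arrowCongr (Equiv.refl Y))

theorem tupleMarginal_tupleLaw {J : Type*} (v : D.commStage n) (p : X → (D.parents v → Y) → ℝ)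
    (r : J → Fin d) (z : J → Y) :
    tupleMarginal (hsym.tupleLaw v p) r z =
      tupleMarginal p (fun j => (hsym.parentEquiv v).symm (r j)) z := by
  rw [← tupleMarginal_reindex (hsym.parentEquiv v)]
  simp only [Equiv.apply_symm_apply]
  rfl

theorem isFinLaw_localLaw (v : D.commStage n) [Fintype (D.parents v → Y)]
    {p : X → (Fin d → Y) → ℝ} (hp : IsFinLaw p) : IsFinLaw (hsym.localLaw p v) :=
  hp.reindex ((hsym.parentEquiv v).arrowCongr (Equiv.refl Y))

theorem finite_common_parents (u v : V) :
    Finite {w : V // w ∈ D.parents u ∧ w ∈ D.parents v} :=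
  Finite.of_injective (fun w => (⟨w.1, w.2.1⟩ : D.parents u))
    fun _ _ h => Subtype.ext (congrArg (fun t : D.parents u => (t : V)) h)

/-- A feasible law of the single-letter problem, placed at every node, is locally consistent. -/
theorem isLocallyConsistent_localLaw {p : X → (Fin d → Y) → ℝ}
    (hp : p ∈ singleLetterFeasible D s ι Q) :
    ch.IsLocallyConsistent n (hsym.localLaw p) where
  law v := by
    classical
    exact hsym.isFinLaw_localLaw v hp.1
  channel v u h b := by
    classical
    change outputLaw (ch.nodeKernel v) _ _ = _
    rw [← hsym.outputLaw_tupleLaw, tupleLaw_localLaw, hp.2.1 (hsym.parentEquiv u ⟨v, h⟩) b]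
    conv_lhs => rw [← hsym.tupleLaw_localLaw p u]
    rw [tupleMarginal_tupleLaw]
    simp
  overlap u v z := by
    classical
    let J := {w : V // w ∈ D.parents u ∧ w ∈ D.parents v}
    have : Finite J := finite_common_parents (D := D) u v
    obtain ⟨k, ⟨g⟩⟩ := Finite.exists_equiv_fin J
    have key : ∀ (v : D.commStage n) (r : J → D.parents v) (z : J → Y),
        tupleMarginal (hsym.localLaw p v) r z =
          tupleMarginal p (fun w => hsym.parentEquiv v (r w)) z := by
      intro v r z
      conv_rhs => rw [← hsym.tupleLaw_localLaw p v]
      rw [tupleMarginal_tupleLaw]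
      simp
    rw [key, key]
    let S : Fin k ↪ Fin d := ⟨fun l => hsym.parentEquiv u ⟨(g.symm l).1, (g.symm l).2.1⟩,
      fun a b h => g.symm.injective (Subtype.ext (congrArg (fun t : D.parents u => (t : V))
        ((hsym.parentEquiv u).injective h)))⟩
    let T : Fin k ↪ Fin d := ⟨fun l => hsym.parentEquiv v ⟨(g.symm l).1, (g.symm l).2.2⟩,
      fun a b h => g.symm.injective (Subtype.ext (congrArg (fun t : D.parents v => (t : V))
        ((hsym.parentEquiv v).injective h)))⟩
    have hST : OrderedSubsetEquiv D s ι S T := by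
      refine ⟨u, (D.mem_commStage.1 u.2).2, v, (D.mem_commStage.1 v.2).2, fun l => ?_⟩
      rw [← hsym.parentEquiv_symm_spec, ← hsym.parentEquiv_symm_spec]
      change ι ((hsym.parentEquiv u).symm (hsym.parentEquiv u _)) =
        ι ((hsym.parentEquiv v).symm (hsym.parentEquiv v _))
      rw [Equiv.symm_apply_apply, Equiv.symm_apply_apply]
    have := tupleMarginal_comp_congr (hp.2.2 k S T hST) g z
    refine (congrArg (fun r => tupleMarginal p r z) (funext fun w => ?_)).trans
      (this.trans (congrArg (fun r => tupleMarginal p r z) (funext fun w => ?_)))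
    · exact congrArg (fun t : J => hsym.parentEquiv u ⟨t.1, t.2.1⟩) (g.symm_apply_apply w).symm
    · exact congrArg (fun t : J => hsym.parentEquiv v ⟨t.1, t.2.2⟩) (g.symm_apply_apply w)

theorem localObjective_localLaw (p : X → (Fin d → Y) → ℝ) (hn : (D.commStage n).card ≠ 0) :
    ch.localObjective n (hsym.localLaw p) = channelInfo Q p := by
  classical
  have h : ∀ v : D.commStage n, channelInfo (ch.localKernel (D.toComm v)) (hsym.localLaw p v) =
      channelInfo Q p := by
    intro v
    change channelInfo (ch.nodeKernel v) _ = _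
    rw [← hsym.channelInfo_tupleLaw, tupleLaw_localLaw]
  unfold localObjective
  rw [div_eq_iff (by exact_mod_cast hn), mul_comm, Finset.sum_congr rfl fun v _ => h v]
  simp

/-- The average over the nodes of the laws of the tuples. -/
noncomputable def averageLaw (p : LocalLaws D X Y n) : X → (Fin d → Y) → ℝ :=
  fun x z => ∑ v, ((D.commStage n).card : ℝ)⁻¹ * hsym.tupleLaw v (p v) x z

variable {p : LocalLaws D X Y n}

theorem isFinLaw_averageLaw (hn : (D.commStage n).card ≠ 0) (hp : ch.IsLocallyConsistent n p) :
    IsFinLaw (hsym.averageLaw p) := by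
  classical
  exact IsFinLaw.sum_smul (fun _ _ => by positivity) (by simp [hn])
    fun v _ => hsym.isFinLaw_tupleLaw v (hp.law v)

/-- The objective of a family is at most that of its average, by concavity. -/
theorem localObjective_le (hp : ch.IsLocallyConsistent n p) :
    ch.localObjective n p ≤ channelInfo Q (hsym.averageLaw p) := by
  classical
  refine le_trans (le_of_eq ?_) (sum_channelInfo_le Finset.univ
    (fun _ => ((D.commStage n).card : ℝ)⁻¹) (fun v : D.commStage n => hsym.tupleLaw v (p v))
    (fun _ _ => by positivity) hsym.law_pos hsym.law_sum
    fun v _ => (hsym.isFinLaw_tupleLaw v (hp.law v)).1)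
  unfold localObjective
  rw [← Finset.mul_sum, div_eq_inv_mul]
  congr 1
  exact Finset.sum_congr rfl fun v _ => (hsym.channelInfo_tupleLaw v (p v)).symm

theorem abs_outputLaw_averageLaw_sub_le (hp : ch.IsLocallyConsistent n p) (i : Fin d) (b : Y) :
    |outputLaw Q (hsym.averageLaw p) b -
      tupleMarginal (hsym.averageLaw p) (fun _ : Unit => i) fun _ => b| ≤
      2 * ((D.boundary d n).card / (D.commStage n).card) := by
  classical
  have hf := fun v => hsym.isFinLaw_tupleLaw v (hp.law v)
  unfold averageLaw
  rw [outputLaw_sum, tupleMarginal_eq_outputLaw, outputLaw_sum, ← Finset.mul_sum,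
    ← Finset.mul_sum, ← mul_sub, abs_mul, abs_of_nonneg (by positivity), div_eq_inv_mul,
    mul_left_comm]
  gcongr
  refine (ChannelDAG.abs_sum_sub_sum_le_shiftDefect hsym.embedding (s i) ?_
    (fun v => outputLaw_nonneg (fun _ _ _ => (hsym.law_pos _ _ _).le) (hf v).1 _)
    (fun v => outputLaw_le_one hsym.law_le_one (hf v) _)
    (fun v => outputLaw_nonneg (selectionChannel_nonneg _) (hf v).1 _)
    (fun v => outputLaw_le_one (selectionChannel_le_one _) (hf v) _)).trans ?_
  · intro u v huv
    have hvu : (v : V) ∈ D.parents u := D.mem_parents.2 ((hsym.induced v u).2 ⟨i, huv⟩)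
    rw [← tupleMarginal_eq_outputLaw, tupleMarginal_tupleLaw, outputLaw_tupleLaw]
    refine (hp.channel v u hvu b).trans ?_
    congr 1
    ext _
    refine hsym.embedding ?_
    rw [hsym.parentEquiv_symm_spec, ← huv, mul_inv_cancel_right]
  · have : ((D.shiftDefect ι n (s i)).card : ℝ) ≤ (D.boundary d n).card := by
      exact_mod_cast hsym.card_shiftDefect_le_boundary i
    linarith [(Nat.cast_nonneg (D.boundary d n).card : (0 : ℝ) ≤ _)]

theorem abs_tupleMarginal_averageLaw_sub_le (hp : ch.IsLocallyConsistent n p) {k : ℕ}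
    {S T : Fin k ↪ Fin d} (hST : OrderedSubsetEquiv D s ι S T) (z : Fin k → Y) :
    |tupleMarginal (hsym.averageLaw p) S z - tupleMarginal (hsym.averageLaw p) T z| ≤
      2 * ((D.boundary d n).card / (D.commStage n).card) := by
  classical
  -- the translation between the nodes of two empty tuples may be arbitrarily long, but there is
  -- only one empty tuple
  rcases Nat.eq_zero_or_pos k with rfl | hk
  · rw [Subsingleton.elim S T, sub_self, abs_zero]
    positivity
  obtain ⟨a, -, b, -, hab⟩ := hST
  have hf := fun v => hsym.isFinLaw_tupleLaw v (hp.law v)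
  unfold averageLaw
  rw [tupleMarginal_eq_outputLaw, tupleMarginal_eq_outputLaw, outputLaw_sum, outputLaw_sum,
    ← Finset.mul_sum, ← Finset.mul_sum, ← mul_sub, abs_mul, abs_of_nonneg (by positivity),
    div_eq_inv_mul, mul_left_comm]
  gcongr
  refine (ChannelDAG.abs_sum_sub_sum_le_shiftDefect hsym.embedding ((ι a)⁻¹ * ι b) ?_
    (fun v => outputLaw_nonneg (selectionChannel_nonneg _) (hf v).1 _)
    (fun v => outputLaw_le_one (selectionChannel_le_one _) (hf v) _)
    (fun v => outputLaw_nonneg (selectionChannel_nonneg _) (hf v).1 _)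
    (fun v => outputLaw_le_one (selectionChannel_le_one _) (hf v) _)).trans ?_
  · intro u v huv
    rw [← tupleMarginal_eq_outputLaw, ← tupleMarginal_eq_outputLaw, tupleMarginal_tupleLaw,
      tupleMarginal_tupleLaw]
    have hw : ∀ l, ((hsym.parentEquiv v).symm (S l) : V) = (hsym.parentEquiv u).symm (T l) := by
      intro l
      refine hsym.embedding ?_
      rw [hsym.parentEquiv_symm_spec, hsym.parentEquiv_symm_spec, ← huv, mul_assoc, mul_assoc,
        ← hab]
      group
    have := finite_common_parents (D := D) v u
    refine (tupleMarginal_comp_congr (K := Fin k) (hp.overlap v u)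
      (fun l => ⟨(hsym.parentEquiv v).symm (S l), ((hsym.parentEquiv v).symm (S l)).2,
        hw l ▸ ((hsym.parentEquiv u).symm (T l)).2⟩) z).trans ?_
    exact congrArg (fun r => tupleMarginal (p u) r z) (funext fun l => Subtype.ext (hw l))
  · have h0 : (ι a)⁻¹ * ι b = (s (S ⟨0, hk⟩))⁻¹ * s (T ⟨0, hk⟩) := by
      rw [inv_mul_eq_iff_eq_mul, ← mul_assoc, hab, inv_mul_cancel_right]
    have h1 := (ChannelDAG.card_shiftDefect_mul_le (n := n) (D := D) hsym.embedding
      (s (S ⟨0, hk⟩))⁻¹ (s (T ⟨0, hk⟩)))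
    rw [ChannelDAG.card_shiftDefect_inv hsym.embedding, ← h0] at h1
    have h2 := hsym.card_shiftDefect_le_boundary (n := n) (S ⟨0, hk⟩)
    have h3 := hsym.card_shiftDefect_le_boundary (n := n) (T ⟨0, hk⟩)
    exact_mod_cast (by omega : _ ≤ 2 * (D.boundary d n).card)

end PosetMarkovChannel.IsApproxSymmetric

/-! ### The single-letter problem -/

/-- A cluster point of a sequence in a compact set satisfies the constraints that the sequence
satisfies asymptotically. -/
theorem IsCompact.exists_asymptotically_feasible {E : Type*} [TopologicalSpace E] {K : Set E}
    (hK : IsCompact K) {𝒟 : Set (E → ℝ)} (h𝒟 : ∀ Δ ∈ 𝒟, Continuous Δ) {g : E → ℝ}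
    (hg : ContinuousOn g K) {x : ℕ → E} (hx : ∀ᶠ n in atTop, x n ∈ K)
    (hlim : ∀ Δ ∈ 𝒟, Tendsto (fun n => Δ (x n)) atTop (𝓝 0)) {c : ℝ}
    (hc : ∃ᶠ n in atTop, c ≤ g (x n)) : ∃ a ∈ K, (∀ Δ ∈ 𝒟, Δ a = 0) ∧ c ≤ g a := by
  have : NeBot (atTop ⊓ 𝓟 {n | c ≤ g (x n)}) := frequently_iff_neBot.1 hc
  set U := Ultrafilter.of (atTop ⊓ 𝓟 {n | c ≤ g (x n)})
  have hU : (U : Filter ℕ) ≤ atTop := (Ultrafilter.of_le _).trans inf_le_left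
  have hUc : ∀ᶠ n in U, c ≤ g (x n) :=
    le_principal_iff.1 ((Ultrafilter.of_le _).trans inf_le_right)
  have hxK : ∀ᶠ n in U, x n ∈ K := hU hx
  obtain ⟨a, ha, hlt⟩ := hK.ultrafilter_le_nhds (U.map x) (le_principal_iff.2 hxK)
  have hlt : Tendsto x U (𝓝 a) := hlt
  refine ⟨a, ha, fun Δ hΔ => ?_, ?_⟩
  · exact tendsto_nhds_unique (((h𝒟 Δ hΔ).tendsto a).comp hlt) ((hlim Δ hΔ).mono_left hU)
  · exact ge_of_tendsto ((hg a ha).tendsto.comp (tendsto_nhdsWithin_iff.2 ⟨hlt, hxK⟩)) hUc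

section SingleLetter

variable {V G X Y : Type*} [Group G] [Fintype X] [Fintype Y] (D : ChannelDAG V) {d : ℕ}
  (s : Fin d → G) (ι : V → G) (Q : X → (Fin d → Y) → Y → ℝ)

/-- The linear functionals that vanish on the feasible laws of the single-letter problem. -/
def singleLetterConstraints : Set ((X → (Fin d → Y) → ℝ) → ℝ) :=
  {Δ | (∃ i b, Δ = fun p => outputLaw Q p b - tupleMarginal p (fun _ : Unit => i) fun _ => b) ∨
    ∃ (k : ℕ) (S T : Fin k ↪ Fin d), OrderedSubsetEquiv D s ι S T ∧
      ∃ z, Δ = fun p => tupleMarginal p S z - tupleMarginal p T z}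

variable {D s ι Q}

theorem mem_singleLetterFeasible_iff {p : X → (Fin d → Y) → ℝ} :
    p ∈ singleLetterFeasible D s ι Q ↔
      IsFinLaw p ∧ ∀ Δ ∈ singleLetterConstraints D s ι Q, Δ p = 0 := by
  refine and_congr_right fun _ => ⟨?_, fun h => ⟨fun i b => ?_, fun k S T hST z => ?_⟩⟩
  · rintro ⟨h1, h2⟩ Δ (⟨i, b, rfl⟩ | ⟨k, S, T, hST, z, rfl⟩)
    · exact sub_eq_zero.2 (h1 i b)
    · exact sub_eq_zero.2 (h2 k S T hST z)
  · exact sub_eq_zero.1 (h _ (.inl ⟨i, b, rfl⟩))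
  · exact sub_eq_zero.1 (h _ (.inr ⟨k, S, T, hST, z, rfl⟩))

theorem continuous_of_mem_singleLetterConstraints {Δ : (X → (Fin d → Y) → ℝ) → ℝ}
    (hΔ : Δ ∈ singleLetterConstraints D s ι Q) : Continuous Δ := by
  obtain ⟨i, b, rfl⟩ | ⟨k, S, T, -, z, rfl⟩ := hΔ
  · exact (continuous_outputLaw Q b).sub (continuous_tupleMarginal _ _)
  · exact (continuous_tupleMarginal _ _).sub (continuous_tupleMarginal _ _)

theorem singleLetterConstraints_sum {Δ : (X → (Fin d → Y) → ℝ) → ℝ}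
    (hΔ : Δ ∈ singleLetterConstraints D s ι Q) {J : Type*} (t : Finset J) (w : J → ℝ)
    (P : J → X → (Fin d → Y) → ℝ) :
    Δ (fun x z => ∑ j ∈ t, w j * P j x z) = ∑ j ∈ t, w j * Δ (P j) := by
  obtain ⟨i, b, rfl⟩ | ⟨k, S, T, -, z, rfl⟩ := hΔ <;>
    simp only [tupleMarginal_eq_outputLaw, outputLaw_sum, mul_sub, Finset.sum_sub_distrib]

theorem isCompact_singleLetterFeasible : IsCompact (singleLetterFeasible D s ι Q) := by
  have : singleLetterFeasible D s ι Q =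
      {p | IsFinLaw p} ∩ ⋂ Δ ∈ singleLetterConstraints D s ι Q, {p | Δ p = 0} := by
    ext p
    simp [mem_singleLetterFeasible_iff]
  rw [this]
  exact isCompact_isFinLaw.inter_right (isClosed_biInter fun Δ hΔ =>
    isClosed_eq (continuous_of_mem_singleLetterConstraints hΔ) continuous_const)

theorem concaveOn_channelInfo_singleLetterFeasible (hQ : ∀ x z b, 0 < Q x z b)
    (hQ1 : ∀ x z, ∑ b, Q x z b = 1) :
    ConcaveOn ℝ (singleLetterFeasible D s ι Q) (channelInfo Q) := by
  have key : ∀ (p q : X → (Fin d → Y) → ℝ) (a b : ℝ), a • p + b • q =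
      fun x z => ∑ j : Fin 2, ![a, b] j * ![p, q] j x z := by
    intro p q a b
    ext x z
    simp
  have hw : ∀ {a b : ℝ}, 0 ≤ a → 0 ≤ b → ∀ j ∈ (Finset.univ : Finset (Fin 2)), 0 ≤ ![a, b] j := by
    intro a b ha hb j _
    fin_cases j
    exacts [ha, hb]
  have hP : ∀ {p q}, p ∈ singleLetterFeasible D s ι Q → q ∈ singleLetterFeasible D s ι Q →
      ∀ j ∈ (Finset.univ : Finset (Fin 2)), ![p, q] j ∈ singleLetterFeasible D s ι Q := by
    intro p q hp hq j _
    fin_cases j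
    exacts [hp, hq]
  refine ⟨fun p hp q hq a b ha hb hab => ?_, fun p hp q hq a b ha hb hab => ?_⟩
  · rw [key, mem_singleLetterFeasible_iff]
    refine ⟨IsFinLaw.sum_smul (hw ha hb) (by simpa using hab) fun j hj => (hP hp hq j hj).1, ?_⟩
    intro Δ hΔ
    rw [singleLetterConstraints_sum hΔ]
    refine Finset.sum_eq_zero fun j hj => ?_
    rw [(mem_singleLetterFeasible_iff.1 (hP hp hq j hj)).2 Δ hΔ, mul_zero]
  · rw [key]
    refine le_trans (le_of_eq ?_) (sum_channelInfo_le _ _ _ (hw ha hb) hQ hQ1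
      fun j hj => (hP hp hq j hj).1.1)
    simp

end SingleLetter

/-! ### The local problem -/

namespace PosetMarkovChannel

variable {V : Type*} {D : ChannelDAG V} {X Y : Type*} [Fintype X] [Fintype Y] [MeasurableSpace Y]
  (ch : PosetMarkovChannel D X Y) {n : ℕ}

theorem isCompact_isLocallyConsistent (n : ℕ) :
    IsCompact {p : LocalLaws D X Y n | ch.IsLocallyConsistent n p} := by
  classical
  refine (isCompact_univ_pi fun v : D.commStage n =>
    isCompact_isFinLaw (A := X) (C := D.parents v → Y)).of_isClosed_subset ?_
    fun p hp v _ => hp.law v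
  have : {p : LocalLaws D X Y n | ch.IsLocallyConsistent n p} =
      (⋂ v : D.commStage n, {p | IsFinLaw (p v)}) ∩
      ((⋂ v : D.commStage n, ⋂ u : D.commStage n, ⋂ h : (v : V) ∈ D.parents u, ⋂ b,
        {p | outputLaw (ch.nodeKernel v) (p v) b =
          tupleMarginal (p u) (fun _ : Unit => ⟨v, h⟩) (fun _ => b)}) ∩
      ⋂ u : D.commStage n, ⋂ v : D.commStage n,
        ⋂ z : {w : V // w ∈ D.parents u ∧ w ∈ D.parents v} → Y,
        {p | tupleMarginal (p u) (fun w => ⟨w.1, w.2.1⟩) z =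
          tupleMarginal (p v) (fun w => ⟨w.1, w.2.2⟩) z}) := by
    ext p
    simp only [Set.mem_inter_iff, Set.mem_iInter, Set.mem_ofPred_eq]
    exact ⟨fun h => ⟨h.law, fun v u hv b => by convert h.channel v u hv b; rfl, h.overlap⟩,
      fun h => ⟨h.1, fun v u hv b => by convert h.2.1 v u hv b; rfl, h.2.2⟩⟩
  rw [this]
  refine IsClosed.inter ?_ (IsClosed.inter ?_ ?_)
  · refine isClosed_iInter fun v => ?_
    exact IsClosed.preimage (f := fun p : LocalLaws D X Y n => p v) (continuous_apply v)
      isClosed_isFinLaw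
  · refine isClosed_iInter fun v => isClosed_iInter fun u => isClosed_iInter fun h =>
      isClosed_iInter fun b => ?_
    exact isClosed_eq ((continuous_outputLaw _ b).comp (continuous_apply v))
      ((continuous_tupleMarginal _ _).comp (continuous_apply u))
  · refine isClosed_iInter fun u => isClosed_iInter fun v => isClosed_iInter fun z => ?_
    exact isClosed_eq ((continuous_tupleMarginal _ _).comp (continuous_apply u))
      ((continuous_tupleMarginal _ _).comp (continuous_apply v))

theorem continuousOn_localObjective (hW : ∀ (v : D.commStage n) x z b, 0 < ch.nodeKernel v x z b)
    (hW1 : ∀ (v : D.commStage n) x z, ∑ b, ch.nodeKernel v x z b = 1) :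
    ContinuousOn (ch.localObjective n) {p | ch.IsLocallyConsistent n p} := by
  classical
  unfold localObjective
  refine ContinuousOn.div_const (continuousOn_finsetSum _ fun v _ => ?_) _
  exact (continuousOn_channelInfo (hW v) (hW1 v)).comp (continuous_apply v).continuousOn
    fun p hp => (hp.law v).1

theorem exists_isLocallyConsistent [Nonempty X] [Nonempty Y] [DiscreteMeasurableSpace Y] (n : ℕ) :
    ∃ p, ch.IsLocallyConsistent n p :=
  ⟨_, ch.isLocallyConsistent_codeLaw one_ne_zero fun _ _ _ => Classical.arbitrary X⟩

theorem exists_isGreatest_localObjective [Nonempty X] [Nonempty Y] [DiscreteMeasurableSpace Y]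
    (hW : ∀ (v : D.commStage n) x z b, 0 < ch.nodeKernel v x z b)
    (hW1 : ∀ (v : D.commStage n) x z, ∑ b, ch.nodeKernel v x z b = 1) :
    ∃ U, IsGreatest (ch.localObjective n '' {p | ch.IsLocallyConsistent n p}) U := by
  obtain ⟨p, hp, hmax⟩ := (ch.isCompact_isLocallyConsistent n).exists_isMaxOn
    (ch.exists_isLocallyConsistent n) (ch.continuousOn_localObjective hW hW1)
  exact ⟨_, ⟨p, hp, rfl⟩, by rintro _ ⟨q, hq, rfl⟩; exact hmax hq⟩

namespace IsApproxSymmetric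

variable {ch} {G : Type*} [Group G] {d : ℕ} {s : Fin d → G} {ι : V → G}
  {Q : X → (Fin d → Y) → Y → ℝ} (hsym : ch.IsApproxSymmetric s ι Q)

/-- The averages of locally consistent families are asymptotically feasible, since the boundary is
negligible. -/
theorem tendsto_constraint_averageLaw {p : ∀ n, LocalLaws D X Y n}
    (hp : ∀ n, ch.IsLocallyConsistent n (p n)) {Δ : (X → (Fin d → Y) → ℝ) → ℝ}
    (hΔ : Δ ∈ singleLetterConstraints D s ι Q) :
    Tendsto (fun n => Δ (hsym.averageLaw (p n))) atTop (𝓝 0) := by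
  refine squeeze_zero_norm (a := fun n =>
    2 * (((D.boundary d n).card : ℝ) / (D.commStage n).card)) (fun n => ?_)
    (by simpa using hsym.boundary_vanishing.const_mul 2)
  rw [Real.norm_eq_abs]
  obtain ⟨i, b, rfl⟩ | ⟨k, S, T, hST, z, rfl⟩ := hΔ
  · exact hsym.abs_outputLaw_averageLaw_sub_le (hp n) i b
  · exact hsym.abs_tupleMarginal_averageLaw_sub_le (hp n) hST z

theorem exists_singleLetterFeasible (hsym : ch.IsApproxSymmetric s ι Q)
    (hcomm : ∀ᶠ n in atTop, (D.commStage n).card ≠ 0)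
    {p : ∀ n, LocalLaws D X Y n} (hp : ∀ n, ch.IsLocallyConsistent n (p n)) {c : ℝ}
    (hc : ∃ᶠ n in atTop, c ≤ ch.localObjective n (p n)) :
    ∃ q ∈ singleLetterFeasible D s ι Q, c ≤ channelInfo Q q := by
  obtain ⟨q, hq, hq', hcq⟩ := isCompact_isFinLaw.exists_asymptotically_feasible
    (𝒟 := singleLetterConstraints D s ι Q)
    (fun Δ hΔ => continuous_of_mem_singleLetterConstraints hΔ)
    ((continuousOn_channelInfo hsym.law_pos hsym.law_sum).mono fun q hq => hq.1)
    (hcomm.mono fun n hn => hsym.isFinLaw_averageLaw hn (hp n))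
    (fun Δ hΔ => hsym.tendsto_constraint_averageLaw hp hΔ)
    (hc.mono fun n hn => hn.trans (hsym.localObjective_le (hp n)))
  exact ⟨q, mem_singleLetterFeasible_iff.2 ⟨hq, hq'⟩, hcq⟩

/-- The maxima of the local problems converge to the maximum of the single-letter problem. -/
theorem tendsto_of_isGreatest (hsym : ch.IsApproxSymmetric s ι Q)
    (hcomm : ∀ᶠ n in atTop, (D.commStage n).card ≠ 0) {U : ℕ → ℝ}
    (hU : ∀ n, IsGreatest (ch.localObjective n '' {p | ch.IsLocallyConsistent n p}) (U n)) {C : ℝ}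
    (hC : IsGreatest (channelInfo Q '' singleLetterFeasible D s ι Q) C) :
    Tendsto U atTop (𝓝 C) := by
  choose p hp hpU using fun n => (hU n).1
  refine tendsto_order.2 ⟨fun c hc => ?_, fun c hc => ?_⟩
  · obtain ⟨q, hq, rfl⟩ := hC.1
    filter_upwards [hcomm] with n hn
    refine hc.trans_le ?_
    rw [← hsym.localObjective_localLaw q hn]
    exact (hU n).2 ⟨_, hsym.isLocallyConsistent_localLaw hq, rfl⟩
  · by_contra h
    obtain ⟨q, hq, hcq⟩ := hsym.exists_singleLetterFeasible hcomm hp (c := c)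
      ((not_eventually.1 h).mono fun n hn => by rw [hpU]; exact not_lt.1 hn)
    exact (hC.2 ⟨q, hq, rfl⟩).not_gt (hc.trans_le hcq)

variable [Nonempty X] [Nonempty Y] [DiscreteMeasurableSpace Y]

theorem exists_isGreatest_singleLetter (hsym : ch.IsApproxSymmetric s ι Q)
    (hcomm : ∀ᶠ n in atTop, (D.commStage n).card ≠ 0) :
    ∃ C, IsGreatest (channelInfo Q '' singleLetterFeasible D s ι Q) C := by
  choose p hp using ch.exists_isLocallyConsistent
  have hne : (singleLetterFeasible D s ι Q).Nonempty := by
    -- only the constraints matter here, so the objective is replaced by a constant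
    obtain ⟨q, hq, hq', -⟩ := isCompact_isFinLaw.exists_asymptotically_feasible
      (𝒟 := singleLetterConstraints D s ι Q) (g := fun _ => 0) (c := 0)
      (fun Δ hΔ => continuous_of_mem_singleLetterConstraints hΔ) continuousOn_const
      (hcomm.mono fun n hn => hsym.isFinLaw_averageLaw hn (hp n))
      (fun Δ hΔ => hsym.tendsto_constraint_averageLaw hp hΔ) (Frequently.of_forall fun _ => le_rfl)
    exact ⟨q, mem_singleLetterFeasible_iff.2 ⟨hq, hq'⟩⟩
  obtain ⟨q, hq, hmax⟩ := isCompact_singleLetterFeasible.exists_isMaxOn hne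
    ((continuousOn_channelInfo hsym.law_pos hsym.law_sum).mono fun q hq => hq.1.1)
  exact ⟨_, ⟨q, hq, rfl⟩, by rintro _ ⟨q', hq', rfl⟩; exact hmax hq'⟩

end IsApproxSymmetric

end PosetMarkovChannel

/-! ### The feedback capacity -/

namespace PosetCausalChannel

variable {V : Type*} {D : ChannelDAG V} {X Y : Type*} [Fintype Y] [MeasurableSpace Y]
  (ch : PosetCausalChannel D X Y) {n M : ℕ} {ε ε' : ℝ}

theorem HasCode.mono (h : ch.HasCode n M ε) (hε : ε ≤ ε') : ch.HasCode n M ε' :=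
  let ⟨f, g, hfg⟩ := h
  ⟨f, g, hfg.trans hε⟩

theorem HasCode.ne_zero [Nonempty Y] (h : ch.HasCode n M ε) : M ≠ 0 := by
  obtain ⟨-, g, -⟩ := h
  rintro rfl
  exact (g fun _ => Classical.arbitrary Y).elim0

theorem hasCode_one [Nonempty X] (hε : 0 ≤ ε) : ch.HasCode n 1 ε := by
  refine ⟨fun _ _ _ => Classical.arbitrary X, fun _ => 0, ?_⟩
  simpa [errorProb, Subsingleton.elim (0 : Fin 1)] using hε

end PosetCausalChannel

namespace PosetMarkovChannel.IsApproxSymmetric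

variable {V G X Y : Type*} [Group G] [Fintype X] [Nonempty X] [Fintype Y] [Nonempty Y]
    [MeasurableSpace Y] [DiscreteMeasurableSpace Y] {D : ChannelDAG V}
    {ch : PosetMarkovChannel D X Y} {d : ℕ} {s : Fin d → G} {ι : V → G}
    {Q : X → (Fin d → Y) → Y → ℝ} {n M : ℕ} {U ε : ℝ}

theorem log_le_of_hasCode (hsym : ch.IsApproxSymmetric s ι Q) (hn : (D.commStage n).card ≠ 0)
    (hU : IsGreatest (ch.localObjective n '' {p | ch.IsLocallyConsistent n p}) U)
    (hε : 0 < ε) (hε1 : ε < 1) (h : ch.HasCode n M ε) :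
    Real.log M ≤ ((D.commStage n).card * U + (-Real.log (1 - ε) - ε * Real.log ε)) / (1 - ε) := by
  classical
  have hM := PosetCausalChannel.HasCode.ne_zero _ h
  obtain ⟨f, g, hfg⟩ := h
  rw [le_div_iff₀' (by linarith)]
  refine (ch.log_messages_le hsym.nodeKernel_pos hsym.sum_nodeKernel hM f g hε hε1 hfg).trans ?_
  gcongr
  have h1 := hU.2 ⟨_, ch.isLocallyConsistent_codeLaw hM f, rfl⟩
  unfold localObjective at h1
  rw [div_le_iff₀' (by positivity)] at h1
  exact h1

theorem bddAbove_hasCode (hsym : ch.IsApproxSymmetric s ι Q) (hn : (D.commStage n).card ≠ 0)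
    (hε : 0 < ε) (hε1 : ε < 1) : BddAbove {M | ch.HasCode n M ε} := by
  obtain ⟨U, hU⟩ := ch.exists_isGreatest_localObjective (n := n) hsym.nodeKernel_pos
    hsym.sum_nodeKernel
  refine ⟨⌈Real.exp (((D.commStage n).card * U + (-Real.log (1 - ε) - ε * Real.log ε)) /
    (1 - ε))⌉₊, fun M hM => Nat.cast_le (α := ℝ).1 (le_trans ?_ (Nat.le_ceil _))⟩
  rw [← Real.exp_log (Nat.cast_pos.2 (Nat.pos_of_ne_zero
    (PosetCausalChannel.HasCode.ne_zero _ hM)))]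
  exact Real.exp_le_exp.2 (hsym.log_le_of_hasCode hn hU hε hε1 hM)

theorem hasCode_maxMessages (hsym : ch.IsApproxSymmetric s ι Q) (hn : (D.commStage n).card ≠ 0)
    (hε : 0 < ε) (hε1 : ε < 1) : ch.HasCode n (ch.maxMessages n ε) ε :=
  Nat.sSup_mem ⟨1, PosetCausalChannel.hasCode_one _ hε.le⟩ (hsym.bddAbove_hasCode hn hε hε1)

theorem maxMessages_mono (hsym : ch.IsApproxSymmetric s ι Q) (hn : (D.commStage n).card ≠ 0)
    {ε' : ℝ} (hε : 0 < ε) (h : ε ≤ ε') (hε1 : ε' < 1) :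
    ch.maxMessages n ε ≤ ch.maxMessages n ε' :=
  le_csSup (hsym.bddAbove_hasCode hn (hε.trans_le h) hε1)
    (PosetCausalChannel.HasCode.mono _ (hsym.hasCode_maxMessages hn hε (h.trans_lt hε1)) h)

/-- The limit in `ε` exists by monotonicity, and Fano's inequality bounds it: the error terms are at
most `-log (1 - ε) - ε log ε`, which vanishes with `ε` even if the stages stay bounded. -/
theorem exists_isFeedbackCapacity (hsym : ch.IsApproxSymmetric s ι Q)
    (hcomm : ∀ᶠ n in atTop, (D.commStage n).card ≠ 0) {C : ℝ} (hC : ch.IsLocalUpperBound C) :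
    ∃ Cfb, ch.toPosetCausalChannel.IsFeedbackCapacity Cfb ∧ Cfb ≤ C := by
  obtain ⟨U, hU, hUC⟩ := hC
  set L : ℝ → EReal := fun ε => liminf (fun n : ℕ =>
    ((Real.log (ch.maxMessages n ε) / (D.commStage n).card : ℝ) : EReal)) atTop with hL
  have hmono : ∀ ε ε', 0 < ε → ε ≤ ε' → ε' < 1 → L ε ≤ L ε' := by
    intro ε ε' hε h hε1
    refine liminf_le_liminf ?_
    filter_upwards [hcomm] with n hn
    rw [EReal.coe_le_coe_iff]
    have h0 := Nat.pos_of_ne_zero (PosetCausalChannel.HasCode.ne_zero _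
      (hsym.hasCode_maxMessages hn hε (h.trans_lt hε1)))
    have h1 := hsym.maxMessages_mono hn hε h hε1
    gcongr
  have hnonneg : ∀ ε, 0 ≤ L ε := fun ε => le_liminf_of_le (h := Eventually.of_forall fun n =>
    EReal.coe_nonneg.2 (div_nonneg (Real.log_natCast_nonneg _) (Nat.cast_nonneg _)))
  set c : ℝ → ℝ := fun ε => -Real.log (1 - ε) - ε * Real.log ε with hc
  have hub : ∀ ε, 0 < ε → ε < 1 → L ε ≤ (((C + c ε) / (1 - ε) : ℝ) : EReal) := by
    intro ε hε hε1
    have hc0 : 0 ≤ c ε := by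
      have h1 := Real.log_nonpos (by linarith : 0 ≤ 1 - ε) (by linarith)
      have h2 := mul_nonpos_of_nonneg_of_nonpos hε.le (Real.log_nonpos hε.le hε1.le)
      simp only [hc]
      linarith
    have hlim : Tendsto (fun n => (((U n + c ε) / (1 - ε) : ℝ) : EReal)) atTop
        (𝓝 (((C + c ε) / (1 - ε) : ℝ) : EReal)) :=
      (continuous_coe_real_ereal.tendsto _).comp ((hUC.add_const _).div_const _)
    rw [← hlim.liminf_eq]
    refine liminf_le_liminf ?_
    filter_upwards [hcomm] with n hn
    rw [EReal.coe_le_coe_iff]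
    have hN : (1 : ℝ) ≤ (D.commStage n).card := by exact_mod_cast Nat.pos_of_ne_zero hn
    have h1 := hsym.log_le_of_hasCode hn (hU n) hε hε1 (hsym.hasCode_maxMessages hn hε hε1)
    rw [div_le_iff₀ (by linarith)]
    refine h1.trans ?_
    rw [div_mul_eq_mul_div]
    have : 0 < 1 - ε := by linarith
    gcongr
    nlinarith
  -- for `ε ≥ 1` every message size is achievable and the supremum is a junk value
  have hmono' : MonotoneOn (fun ε => L (min ε (1 / 2))) (Set.Ioi 0) := by
    intro ε hε ε' _ h
    exact hmono _ _ (lt_min hε (by norm_num)) (min_le_min_right _ h)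
      ((min_le_right _ _).trans_lt (by norm_num))
  have hsmall : ∀ᶠ ε : ℝ in 𝓝[>] 0, 0 < ε ∧ ε < 1 / 2 :=
    Ioo_mem_nhdsGT (by norm_num)
  obtain ⟨l, hl⟩ : ∃ l, Tendsto L (𝓝[>] 0) (𝓝 l) := by
    refine ⟨_, (hmono'.tendsto_nhdsGT (OrderBot.bddBelow _)).congr' ?_⟩
    filter_upwards [hsmall] with ε hε
    rw [min_eq_left hε.2.le]
  have hl0 : 0 ≤ l := ge_of_tendsto hl (Eventually.of_forall hnonneg)
  have hlC : l ≤ (C : EReal) := by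
    have hcont : ContinuousAt (fun ε : ℝ => (C + c ε) / (1 - ε)) 0 := by
      have h1 : ContinuousAt (fun ε : ℝ => Real.log (1 - ε)) 0 :=
        ContinuousAt.log (by fun_prop) (by norm_num)
      have h2 : ContinuousAt (fun ε : ℝ => ε * Real.log ε) 0 :=
        Real.continuous_mul_log.continuousAt
      exact ContinuousAt.div (continuousAt_const.add (h1.neg.sub h2)) (by fun_prop) (by norm_num)
    have hlim : Tendsto (fun ε : ℝ => (((C + c ε) / (1 - ε) : ℝ) : EReal)) (𝓝[>] 0)
        (𝓝 (C : EReal)) := by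
      have h1 := hcont.tendsto
      simp only [hc, sub_zero, Real.log_one, neg_zero, zero_mul, add_zero, div_one] at h1
      exact (continuous_coe_real_ereal.tendsto _).comp (h1.mono_left nhdsWithin_le_nhds)
    refine le_of_tendsto_of_tendsto hl hlim ?_
    filter_upwards [hsmall] with ε hε
    exact hub ε hε.1 (hε.2.trans (by norm_num))
  have hcoe : ((l.toReal : ℝ) : EReal) = l :=
    EReal.coe_toReal (ne_top_of_le_ne_top (EReal.coe_ne_top _) hlC)
      (ne_bot_of_le_ne_bot EReal.zero_ne_bot hl0)
  refine ⟨l.toReal, ?_, ?_⟩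
  · unfold PosetCausalChannel.IsFeedbackCapacity
    rw [hcoe]
    exact hl
  · rw [← EReal.coe_le_coe_iff, hcoe]
    exact hlC

end PosetMarkovChannel.IsApproxSymmetric

theorem mainTheorem1 {V G X Y : Type*} [Group G] [Fintype X] [Nonempty X] [Fintype Y] [Nonempty Y]
    [MeasurableSpace Y] [DiscreteMeasurableSpace Y]
    (D : ChannelDAG V) (hcomm : D.comm.Nonempty) (ch : PosetMarkovChannel D X Y)
    {d : ℕ} (s : Fin d → G) (ι : V → G) (Q : X → (Fin d → Y) → Y → ℝ)
    (hsym : ch.IsApproxSymmetric s ι Q) :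
    ConcaveOn ℝ (singleLetterFeasible D s ι Q) (channelInfo Q) ∧
      ∃ Cfb Cub : ℝ,
        ch.toPosetCausalChannel.IsFeedbackCapacity Cfb ∧
        ch.IsLocalUpperBound Cub ∧
        IsGreatest (channelInfo Q '' singleLetterFeasible D s ι Q) Cub ∧
        Cfb ≤ Cub := by
  refine ⟨concaveOn_channelInfo_singleLetterFeasible hsym.law_pos hsym.law_sum, ?_⟩
  have hev : ∀ᶠ n in atTop, (D.commStage n).card ≠ 0 := by
    obtain ⟨v, hv⟩ := hcomm
    obtain ⟨m, hm⟩ := D.stage_exhaust v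
    filter_upwards [eventually_ge_atTop m] with n hn
    exact Finset.card_ne_zero_of_mem
      (D.mem_commStage.2 ⟨monotone_nat_of_le_succ D.stage_mono hn hm, hv⟩)
  obtain ⟨Cub, hCub⟩ := hsym.exists_isGreatest_singleLetter hev
  choose U hU using fun n => ch.exists_isGreatest_localObjective (n := n) hsym.nodeKernel_pos
    hsym.sum_nodeKernel
  have hloc : ch.IsLocalUpperBound Cub := ⟨U, hU, hsym.tendsto_of_isGreatest hev hU hCub⟩
  obtain ⟨Cfb, hCfb, hle⟩ := hsym.exists_isFeedbackCapacity hev hloc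
  exact ⟨Cfb, Cub, hCfb, hloc, hCub, hle⟩
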